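/- Let $m,n\ge 2$, let $p_1,\dots,p_n$ be homogeneous polynomials of degree $m$ in $z=(z_1,\dots,z_n)$ over $\mathbb C$, and let $\mathbf P:\mathbb C^n\to\mathbb C^n$, $z\mapsto(p_1(z),\dots,p_n(z))$. Let $\mathcal O_n$ be the algebra of germs at the origin of holomorphic functions on $\mathbb C^n$, and let $I\subset\mathcal O_n$ be the ideal generated by the germs of $p_1,\dots,p_n$. Assume that $\dim_{\mathbb C}\mathcal O_n/I<\infty$, and let $\mathcal A$ be any commutative associative unital $\mathbb C$-algebra isomorphic to $\mathcal O_n/I$. Then $\mathcal A$ is local; denote its maximal ideal by $\mathfrak m$. The following holds. (1) $n=\dim_{\mathbb C}\mathfrak m/\mathfrak m^2$. (2) There is a largest integer $\nu$ with $\mathfrak m^\nu\ne 0$ (the nil-index of $\mathfrak m$); it is divisible by $n$, and $m=\nu/n+1$. (3) Let $f=(f_1,\dots,f_n)$ be any basis of any complement to $\mathfrak m^2$ in $\mathfrak m$. Let $q_1,\dots,q_K$ be all the monomials of degree $m$ in $n$ variables, where $K=\binom{m+n-1}{m}$, and put $q=(q_1,\dots,q_K)$. Let $\mathcal S$ be any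 complement to $\mathfrak m^{m+1}$ in $\mathfrak m^m$, and let $\pi:\mathfrak m^m\to\mathcal S$ be the projection with kernel $\mathfrak m^{m+1}$. Then there exists an $n\times K$ complex matrix $\Gamma=(\gamma_{\sigma\rho})$ with linearly independent rows such that $$\sum_{\rho=1}^K\gamma_{\sigma\rho}\,\pi(q_\rho(f))=0,\qquad \sigma=1,\dots,n.$$ Moreover, for every such matrix $\Gamma$ the map $\Phi:\mathbb C^n\to\mathbb C^n$, $\Phi(z)=\Gamma q(z)$, is linearly equivalent to $\mathbf P$, that is, $\mathbf P=L_1\circ\Phi\circ L_2$ for some invertible linear transformations $L_1,L_2$ of $\mathbb C^n$. -/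

import Mathlib

open scoped Topology

noncomputable section

namespace FinitePolyMap

/-- Complex-valued functions on `ℂⁿ` that are holomorphic near the origin. -/
def holoAtZero (n : ℕ) : Subalgebra ℂ ((Fin n → ℂ) → ℂ) where
  carrier := {g | AnalyticAt ℂ g 0}
  mul_mem' ha hb := AnalyticAt.mul ha hb
  add_mem' ha hb := AnalyticAt.add ha hb
  algebraMap_mem' c := analyticAt_const (v := c)

/-- The functions in `holoAtZero n` that vanish identically near the origin, i.e. those
whose germ at the origin is zero. -/
def zeroGerms (n : ℕ) : Ideal (holoAtZero n) where
  carrier := {g | ∀ᶠ z in 𝓝 (0 : Fin n → ℂ), g.1 z = 0}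
  zero_mem' := Filter.Eventually.of_forall fun _ => rfl
  add_mem' {a b} ha hb := by
    filter_upwards [ha, hb] with z h1 h2
    change a.1 z + b.1 z = 0
    rw [h1, h2, add_zero]
  smul_mem' c a ha := by
    filter_upwards [ha] with z h
    change c.1 z * a.1 z = 0
    rw [h, mul_zero]

/-- The algebra `𝒪ₙ` of germs at the origin of holomorphic functions on `ℂⁿ`: two functions
are identified when they agree near the origin. -/
def HoloGerm (n : ℕ) : Type := holoAtZero n ⧸ zeroGerms n

instance (n : ℕ) : CommRing (HoloGerm n) := Ideal.Quotient.commRing (zeroGerms n)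

instance (n : ℕ) : Algebra ℂ (HoloGerm n) := Ideal.Quotient.algebra ℂ (I := zeroGerms n)

/-- The germ at the origin of a polynomial. -/
def polyGerm {n : ℕ} (p : MvPolynomial (Fin n) ℂ) : HoloGerm n :=
  Ideal.Quotient.mk (zeroGerms n)
    ⟨fun z => MvPolynomial.eval z p, AnalyticOnNhd.eval_mvPolynomial p 0 (Set.mem_univ _)⟩

/-- The ideal of `𝒪ₙ` generated by the germs of `p₁, …, pₙ`. -/
def germIdeal {n : ℕ} (p : Fin n → MvPolynomial (Fin n) ℂ) : Ideal (HoloGerm n) :=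
  Ideal.span (Set.range fun r => polyGerm (p r))

/-- The algebra `𝒪ₙ / (p₁, …, pₙ)`. -/
def GermAlg {n : ℕ} (p : Fin n → MvPolynomial (Fin n) ℂ) : Type :=
  HoloGerm n ⧸ germIdeal p

instance {n : ℕ} (p : Fin n → MvPolynomial (Fin n) ℂ) : CommRing (GermAlg p) :=
  Ideal.Quotient.commRing (germIdeal p)

instance {n : ℕ} (p : Fin n → MvPolynomial (Fin n) ℂ) : Algebra ℂ (GermAlg p) :=
  Ideal.Quotient.algebra ℂ (I := germIdeal p)

/-- The map `ℂⁿ → ℂⁿ` with components `p₁, …, pₙ`. -/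
def polyMap {n : ℕ} (p : Fin n → MvPolynomial (Fin n) ℂ) : (Fin n → ℂ) → (Fin n → ℂ) :=
  fun z r => MvPolynomial.eval z (p r)

/-- `Φ₂ = L₁ ∘ Φ₁ ∘ L₂` for some non-degenerate linear transformations `L₁`, `L₂`. -/
def LinearlyEquivalent {n : ℕ} (Φ₁ Φ₂ : (Fin n → ℂ) → (Fin n → ℂ)) : Prop :=
  ∃ L₁ L₂ : (Fin n → ℂ) ≃ₗ[ℂ] (Fin n → ℂ), Φ₂ = L₁ ∘ Φ₁ ∘ L₂

/-- `ν` is the nil-index of `𝔪`: the largest integer `μ` with `𝔪 ^ μ ≠ 0`. -/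
def IsNilIndex {B : Type*} [CommRing B] (𝔪 : Ideal B) (ν : ℕ) : Prop :=
  IsGreatest {μ : ℕ | 𝔪 ^ μ ≠ ⊥} ν

/-- The ideal `J`, intersected with the ideal `I`, as a complex subspace of `I`. -/
def subspaceIn {B : Type*} [CommRing B] [Algebra ℂ B] (I J : Ideal B) : Submodule ℂ I :=
  (J.restrictScalars ℂ).comap ((Submodule.subtype I).restrictScalars ℂ)

/-- Exponent vectors of the monomials of degree `m` in `n` variables. -/
abbrev MonoIdx (n m : ℕ) : Type := {d : Fin n → ℕ // d ∈ Finset.piAntidiag Finset.univ m}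

/-- The value at `x` of the monomial `q_ρ` of degree `m` in `n` variables. -/
def mono {n m : ℕ} {R : Type*} [CommRing R] (ρ : MonoIdx n m) (x : Fin n → R) : R :=
  ∏ i, x i ^ ρ.1 i

theorem mono_mem {n m : ℕ} {B : Type*} [CommRing B] (I : Ideal B) (ρ : MonoIdx n m)
    (x : Fin n → I) : mono ρ (fun i => (x i : B)) ∈ I ^ m := by
  have h : ∑ i, ρ.1 i = m := (Finset.mem_piAntidiag.1 ρ.2).1
  have h' : mono ρ (fun i => (x i : B)) ∈ ∏ i, I ^ ρ.1 i :=
    Ideal.prod_mem_prod fun i _ => Ideal.pow_mem_pow (x i).2 _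
  rwa [Finset.prod_pow_eq_pow_sum, h] at h'

/-- The value of the degree `m` monomial `q_ρ` at a tuple of elements of `I`, as an element
of `I ^ m`. -/
def monoIn {n m : ℕ} {B : Type*} [CommRing B] (I : Ideal B) (ρ : MonoIdx n m)
    (x : Fin n → I) : ↥(I ^ m) :=
  ⟨mono ρ (fun i => (x i : B)), mono_mem I ρ x⟩

/-- The rows of `Γ` are `n` linearly independent linear relations among the vectors
`π (q_ρ (f))`, where `π : 𝔪 ^ m → S` is the projection onto the complement `S` of
`𝔪 ^ (m + 1)` in `𝔪 ^ m`, with kernel `𝔪 ^ (m + 1)`. -/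
def IsRelationMatrix {n m : ℕ} {B : Type*} [CommRing B] [Algebra ℂ B] (𝔪 : Ideal B)
    (f : Fin n → 𝔪) (S : Submodule ℂ ↥(𝔪 ^ m))
    (hS : IsCompl S (subspaceIn (𝔪 ^ m) (𝔪 ^ (m + 1))))
    (Γ : Matrix (Fin n) (MonoIdx n m) ℂ) : Prop :=
  LinearIndependent ℂ Γ.row ∧
    ∀ σ, ∑ ρ, Γ σ ρ • Submodule.projectionOnto S _ hS (monoIn 𝔪 ρ f) = 0

/-- The reconstructed map `z ↦ Γ q(z)`. -/
def recMap {n m : ℕ} (Γ : Matrix (Fin n) (MonoIdx n m) ℂ) : (Fin n → ℂ) → (Fin n → ℂ) :=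
  fun z => Γ.mulVec fun ρ => mono ρ z

end FinitePolyMap

end

/-! Write `M` for the ideal of the variables in `ℂ[z]` and `P` for the polynomial ideal generated by
the forms `p r`. Taylor expansion and Hadamard's lemma identify `𝒪ₙ / I` with `ℂ[z] / P`
(`ker_toGermAlg`, `toGermAlg_surjective`). Finite dimension puts a power of `M` inside `P`, so the
image of `M` is the only maximal ideal `𝔪`. Since `m ≥ 2`, there are no relations in degree 1, so
`𝔪/𝔪²` has dimension `n`.

The core is `linearIndependent_and_finrank_degComp`: `P` has the Hilbert function of `(X₁ᵐ, …,
Xₙᵐ)`. The powers `Xᵢᵐ` form a regular sequence of length `n`. An exchange argument with prime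
avoidance moves it, keeping the length, into the linear span of the `p r`. Regular sequences of
equally many forms of equal degree generate ideals with equal Hilbert functions, and a dimension
count in degree `m` shows that the new sequence generates all of `P`. Hence the `p r` are linearly
independent and the last nonzero degree of `ℂ[z] / P` is `n(m - 1)`, the nil-index.

For the reconstruction, a basis `f` of a complement to `𝔪²` agrees modulo `𝔪²` with an invertible
linear change `c` of the variables, and passing to linear parts alters degree `m` monomials only by
elements of `𝔪 ^ (m + 1)`. So relations among the `π (q_ρ (f))` are exactly the forms that `c`
carries into the span of the `p r` (`relation_iff`). Any `n` independent relations become a basis of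
that span, which is linear equivalence. -/

namespace FinitePolyMap

/-! ### Regular sequences: exchange and prime avoidance. -/

section RegularSequences

variable {R : Type*} [CommRing R]

/-- `x` is a non-zero-divisor modulo the ideal `J`. -/
def RegMod (J : Ideal R) (x : R) : Prop := ∀ u, x * u ∈ J → u ∈ J

/-- `J'` arises from `J` by adjoining `k` elements of `V` that form a regular sequence
modulo `J`. -/
inductive RegChain (V : Set R) : ℕ → Ideal R → Ideal R → Prop
  | nil (J : Ideal R) : RegChain V 0 J J
  | cons {k : ℕ} {J J' : Ideal R} {x : R} (hx : x ∈ V) (hreg : RegMod J x)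
      (h : RegChain V k (J ⊔ Ideal.span {x}) J') : RegChain V (k + 1) J J'

theorem RegChain.mono {V W : Set R} (hVW : V ⊆ W) {k : ℕ} {J J' : Ideal R}
    (h : RegChain V k J J') : RegChain W k J J' := by
  induction h with
  | nil J => exact .nil J
  | cons hx hreg _ ih => exact .cons (hVW hx) hreg ih

theorem RegChain.le_of_le {V : Set R} {k : ℕ} {J J' Q : Ideal R} (h : RegChain V k J J')
    (hV : V ⊆ Q) (hJ : J ≤ Q) : J' ≤ Q := by
  induction h with
  | nil J => exact hJ
  | cons hx _ _ ih =>
    exact ih (sup_le hJ ((Ideal.span_singleton_le_iff_mem _).2 (hV hx)))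

/-- The socle of `R ⧸ J` with respect to the ideal `M` is zero. -/
def SocZero (M J : Ideal R) : Prop := ∀ u, (∀ x ∈ M, x * u ∈ J) → u ∈ J

theorem RegMod.socZero {M J : Ideal R} {x : R} (hx : x ∈ M) (h : RegMod J x) : SocZero M J :=
  fun u hu => h u (hu x hx)

theorem mem_sup_span_singleton {J : Ideal R} {x u : R} :
    u ∈ J ⊔ Ideal.span {x} ↔ ∃ a, u - x * a ∈ J := by
  rw [Submodule.mem_sup]
  constructor
  · rintro ⟨j, hj, b, hb, rfl⟩
    obtain ⟨a, rfl⟩ := Ideal.mem_span_singleton'.1 hb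
    exact ⟨a, by simpa [mul_comm] using hj⟩
  · rintro ⟨a, ha⟩
    exact ⟨_, ha, x * a, Ideal.mul_mem_right _ _ (Ideal.mem_span_singleton_self x), by ring⟩

/-- If `x * u ≡ y * v` modulo `J`, then `v ≡ x * w` and `x` cancels. Only this half of the
transposition is automatic; regularity of `y` modulo `J` itself has to come from the choice of `y`.
-/
theorem RegMod.swap {J : Ideal R} {x y : R} (hxy : RegMod (J ⊔ Ideal.span {x}) y) (hx : RegMod J x) :
    RegMod (J ⊔ Ideal.span {y}) x := by
  intro u hu
  obtain ⟨v, hv⟩ := mem_sup_span_singleton.1 hu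
  have h1 : y * v ∈ J ⊔ Ideal.span {x} :=
    mem_sup_span_singleton.2 ⟨u, by simpa using J.neg_mem hv⟩
  obtain ⟨w, hw⟩ := mem_sup_span_singleton.1 (hxy v h1)
  refine mem_sup_span_singleton.2 ⟨w, hx _ ?_⟩
  have := J.add_mem hv (J.mul_mem_left y hw)
  convert this using 1
  ring

/-- For regular `x`, `y`, the equation `y * u ≡ x * v` modulo `J` turns a socle element `u` modulo
`J + (x)` into a socle element `v` modulo `J + (y)`. If `v ≡ y * b`, cancelling `y` gives `u ≡ x *
b`. -/
theorem SocZero.exchange {M J : Ideal R} {x y : R} (hyM : y ∈ M)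
    (hx : RegMod J x) (hy : RegMod J y) (h : SocZero M (J ⊔ Ideal.span {y})) :
    SocZero M (J ⊔ Ideal.span {x}) := by
  intro u hu
  obtain ⟨v, hv⟩ := mem_sup_span_singleton.1 (hu y hyM)
  have hv' : v ∈ J ⊔ Ideal.span {y} := by
    refine h v fun w hw => ?_
    obtain ⟨a, ha⟩ := mem_sup_span_singleton.1 (hu w hw)
    refine mem_sup_span_singleton.2 ⟨a, hx _ ?_⟩
    have := J.sub_mem (J.mul_mem_left y ha) (J.mul_mem_left w hv)
    convert this using 1
    ring
  obtain ⟨b, hb⟩ := mem_sup_span_singleton.1 hv'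
  refine mem_sup_span_singleton.2 ⟨b, hy _ ?_⟩
  have := J.add_mem hv (J.mul_mem_left x hb)
  convert this using 1
  ring

variable {K : Type*} [Field K] [Infinite K] [Algebra K R] [IsNoetherianRing R]

/-- Prime avoidance inside a linear subspace `V` over an infinite field. -/
theorem exists_mem_regMod {M : Ideal R} (hM : M.IsMaximal) (V : Submodule K R) {N : ℕ}
    (hV : M ^ N ≤ Ideal.span (V : Set R)) (s : Finset (Ideal R))
    (hs : ∀ J ∈ s, SocZero M J) : ∃ y ∈ V, ∀ J ∈ s, RegMod J y := by
  classical
  have hfin : ∀ J : Ideal R, (associatedPrimes R (R ⧸ J)).Finite :=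
    fun J => associatedPrimes.finite R (R ⧸ J)
  let T : Finset (Ideal R) := s.biUnion fun J => (hfin J).toFinset
  let U : Finset (Submodule K V) :=
    T.image fun Q => (Q.restrictScalars K).comap V.subtype
  -- An associated prime containing `V` contains `M ^ N`, so it equals `M`; the element whose
  -- annihilator it is would then be a nonzero socle element.
  have hU : ⊤ ∉ U := by
    intro htop
    obtain ⟨Q, hQ, hQV⟩ := Finset.mem_image.1 htop
    obtain ⟨J, hJ, hQJ⟩ := Finset.mem_biUnion.1 hQ
    rw [Set.Finite.mem_toFinset, AssociatedPrimes.mem_iff] at hQJ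
    have hQp : Q.IsPrime := hQJ.isPrime
    have hVQ : (V : Set R) ⊆ Q := fun v hv => by
      have : (⟨v, hv⟩ : V) ∈ (Q.restrictScalars K).comap V.subtype := by
        rw [hQV]; trivial
      simpa using this
    have hMQ : M = Q :=
      hM.eq_of_le hQp.ne_top (hQp.le_of_pow_le (hV.trans (Ideal.span_le.2 hVQ)))
    obtain ⟨-, f, hf⟩ := (isAssociatedPrime_iff_exists_injective_linearMap _ _).1 hQJ
    obtain ⟨u, hu⟩ := Ideal.Quotient.mk_surjective (f 1)
    have huJ : u ∈ J := by
      refine hs J hJ u fun x hx => ?_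
      rw [hMQ] at hx
      have hx1 : x • (1 : R ⧸ Q) = 0 := by
        rw [Algebra.smul_def, mul_one]
        exact Ideal.Quotient.eq_zero_iff_mem.2 hx
      rw [← Ideal.Quotient.eq_zero_iff_mem, map_mul, hu]
      have := f.map_smul x 1
      rw [hx1, map_zero, Algebra.smul_def] at this
      exact this.symm
    have hf0 : f 1 = 0 := by rw [← hu]; exact Ideal.Quotient.eq_zero_iff_mem.2 huJ
    have h10 : (1 : R ⧸ Q) = 0 := hf (by rw [hf0, map_zero])
    exact hQp.ne_top ((Ideal.eq_top_iff_one _).2 (Ideal.Quotient.eq_zero_iff_mem.1 h10))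
  -- A vector space over an infinite field is not a finite union of proper subspaces.
  have := Subspace.biUnion_ne_univ_of_top_notMem hU
  obtain ⟨y, hy⟩ := (Set.ne_univ_iff_exists_notMem _).1 this
  refine ⟨y, y.2, fun J hJ u hu => ?_⟩
  by_contra huJ
  apply hy
  have hmem : (y : R) ∈ ⋃ p ∈ associatedPrimes R (R ⧸ J), (p : Set R) := by
    rw [biUnion_associatedPrimes_eq_zero_divisors]
    refine ⟨Ideal.Quotient.mk J u, by rwa [Ne, Ideal.Quotient.eq_zero_iff_mem], ?_⟩
    rw [Algebra.smul_def, Ideal.Quotient.algebraMap_eq, ← map_mul, Ideal.Quotient.eq_zero_iff_mem]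
    exact hu
  obtain ⟨Q, hQ, hyQ⟩ := Set.mem_iUnion₂.1 hmem
  refine Set.mem_iUnion₂.2 ⟨(Q.restrictScalars K).comap V.subtype, ?_, by simpa using hyQ⟩
  exact Finset.mem_image_of_mem _
    (Finset.mem_biUnion.2 ⟨J, hJ, (Set.Finite.mem_toFinset _).2 hQ⟩)

/-- If `R ⧸ J` carries a regular sequence of length `k + 1` in `M`, then so does, with length `k`,
its quotient by any regular element of `M`. -/
theorem RegChain.exists_sup_span (K : Type*) [Field K] [Infinite K] [Algebra K R]
    {M : Ideal R} (hM : M.IsMaximal) {k : ℕ} :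
    ∀ {J J' : Ideal R} {x : R}, RegChain (M : Set R) (k + 1) J J' → x ∈ M → RegMod J x →
      ∃ J'', RegChain (M : Set R) k (J ⊔ Ideal.span {x}) J'' := by
  classical
  induction k with
  | zero => exact fun _ _ _ => ⟨_, .nil _⟩
  | succ k ih =>
    intro J J' x h hxM hx
    cases h with
    | @cons _ _ _ w hwM hw h =>
    have hsoc : SocZero M (J ⊔ Ideal.span {w}) := by
      cases h with
      | cons hvM hv _ => exact hv.socZero hvM
    -- The element `y` is a bridge from `w` to `x`: being regular modulo all three ideals, it can be
    -- transposed first with `w` and then with `x`, the induction hypothesis applying once on each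
    -- side.
    obtain ⟨y, hyM, hy⟩ := exists_mem_regMod (K := K) hM (M.restrictScalars K) (N := 1)
      (by rw [pow_one]; exact Ideal.subset_span)
      {J, J ⊔ Ideal.span {x}, J ⊔ Ideal.span {w}} (by
        simp only [Finset.mem_insert, Finset.mem_singleton]
        rintro _ (rfl | rfl | rfl)
        · exact hx.socZero hxM
        · exact hsoc.exchange hwM hx hw
        · exact hsoc)
    simp only [Finset.mem_insert, Finset.mem_singleton, forall_eq_or_imp, forall_eq] at hy
    obtain ⟨hyJ, hyx, hyw⟩ := hy
    replace hyM : y ∈ M := hyM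
    obtain ⟨J₁, h₁⟩ := ih h hyM hyw
    rw [sup_right_comm] at h₁
    obtain ⟨J₂, h₂⟩ := ih (.cons hwM (hyw.swap hw) h₁) hxM (hyx.swap hx)
    rw [sup_right_comm] at h₂
    exact ⟨J₂, .cons hyM hyx h₂⟩

/-- A regular sequence in `M` can be replaced by one of the same length in a linear subspace that
generates an ideal containing a power of `M`. -/
theorem RegChain.exists_in_subspace {M : Ideal R} (hM : M.IsMaximal) (V : Submodule K R) {N : ℕ}
    (hV : M ^ N ≤ Ideal.span (V : Set R)) (hVM : (V : Set R) ⊆ M) {k : ℕ} :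
    ∀ {J J' : Ideal R}, RegChain (M : Set R) k J J' → ∃ J'', RegChain (V : Set R) k J J'' := by
  induction k with
  | zero => exact fun _ => ⟨_, .nil _⟩
  | succ k ih =>
    intro J J' h
    have hsoc : SocZero M J := by
      cases h with
      | cons hvM hv _ => exact hv.socZero hvM
    obtain ⟨y, hyV, hy⟩ := exists_mem_regMod hM V hV {J} (by simpa using hsoc)
    replace hy : RegMod J y := hy J (by simp)
    obtain ⟨J₁, h₁⟩ := RegChain.exists_sup_span K hM h (hVM hyV) hy
    obtain ⟨J₂, h₂⟩ := ih h₁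
    exact ⟨J₂, .cons hyV hy h₂⟩

end RegularSequences
-- Hilbert functions of ideals generated by forms of degree `m`.
section HilbertFunction

open MvPolynomial

attribute [local instance] MvPolynomial.gradedAlgebra

theorem coe_decompose_eq_homogeneousComponent {σ K : Type*} [CommRing K] (a : MvPolynomial σ K)
    (d : ℕ) : (DirectSum.decompose (homogeneousSubmodule σ K) a d : MvPolynomial σ K) =
      homogeneousComponent d a :=
  decomposition.decompose'_apply a d

theorem homogeneousComponent_add_mul {σ K : Type*} [CommRing K] {q : MvPolynomial σ K} {m : ℕ}
    (hq : q.IsHomogeneous m) (a : MvPolynomial σ K) (d : ℕ) :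
    homogeneousComponent (m + d) (q * a) = q * homogeneousComponent d a := by
  rw [← coe_decompose_eq_homogeneousComponent, ← coe_decompose_eq_homogeneousComponent]
  exact DirectSum.coe_decompose_mul_add_of_left_mem (homogeneousSubmodule σ K) hq

theorem homogeneousComponent_mul_of_lt {σ K : Type*} [CommRing K] {q : MvPolynomial σ K} {m : ℕ}
    (hq : q.IsHomogeneous m) (a : MvPolynomial σ K) {d : ℕ} (hd : d < m) :
    homogeneousComponent d (q * a) = 0 := by
  rw [← coe_decompose_eq_homogeneousComponent]
  exact DirectSum.coe_decompose_mul_of_left_mem_of_not_le (homogeneousSubmodule σ K) hq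
    (not_le.2 hd)

theorem isHomogeneous_span_singleton {σ K : Type*} [CommRing K] {q : MvPolynomial σ K} {m : ℕ}
    (hq : q.IsHomogeneous m) :
    (Ideal.span {q}).IsHomogeneous (homogeneousSubmodule σ K) := by
  refine Ideal.homogeneous_span _ _ ?_
  rintro x rfl
  exact ⟨m, hq⟩

variable {n : ℕ} {K : Type*} [Field K]

/-- The degree `d` component of an ideal of a polynomial ring. -/
noncomputable def degComp (J : Ideal (MvPolynomial (Fin n) K)) (d : ℕ) : Submodule K (MvPolynomial (Fin n) K) :=
  homogeneousSubmodule (Fin n) K d ⊓ J.restrictScalars K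

theorem mem_degComp {J : Ideal (MvPolynomial (Fin n) K)} {d : ℕ} {f : MvPolynomial (Fin n) K} :
    f ∈ degComp J d ↔ f.IsHomogeneous d ∧ f ∈ J := Iff.rfl

instance finite_homogeneousSubmodule (d : ℕ) :
    Module.Finite K (homogeneousSubmodule (Fin n) K d) :=
  Module.Finite.iff_fg.2 (homogeneousSubmodule_fg _ _ d)

instance finite_degComp (J : Ideal (MvPolynomial (Fin n) K)) (d : ℕ) :
    Module.Finite K (degComp J d) :=
  Submodule.finiteDimensional_of_le inf_le_left

variable {J : Ideal (MvPolynomial (Fin n) K)} {q : MvPolynomial (Fin n) K} {m : ℕ}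

theorem degComp_sup_of_lt (hJ : J.IsHomogeneous (homogeneousSubmodule (Fin n) K))
    (hq : q.IsHomogeneous m) {d : ℕ} (hd : d < m) :
    degComp (J ⊔ Ideal.span {q}) d = degComp J d := by
  refine le_antisymm (fun f hf => ?_) fun f hf => ⟨hf.1, (le_sup_left : J ≤ _) hf.2⟩
  obtain ⟨a, ha⟩ := mem_sup_span_singleton.1 hf.2
  have := homogeneousComponent_mem_of_mem hJ ha d
  rw [map_sub, homogeneousComponent_mul_of_lt hq a hd, sub_zero,
    homogeneousComponent_eq_self hf.1] at this
  exact ⟨hf.1, this⟩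

/-- In degree `m + d` the new ideal is the sum of `J` and `q` times all forms of degree `d`. By
regularity these meet exactly in `q` times the degree `d` part of `J`, and multiplication by `q`
preserves dimensions. -/
theorem finrank_degComp_sup (hJ : J.IsHomogeneous (homogeneousSubmodule (Fin n) K))
    (hJ1 : J ≠ ⊤) (hq : q.IsHomogeneous m) (hreg : RegMod J q) (d : ℕ) :
    Module.finrank K (degComp (J ⊔ Ideal.span {q}) (m + d)) + Module.finrank K (degComp J d) =
      Module.finrank K (degComp J (m + d)) +
        Module.finrank K (homogeneousSubmodule (Fin n) K d) := by
  have hq0 : q ≠ 0 := by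
    rintro rfl
    exact hJ1 ((Ideal.eq_top_iff_one _).2 (hreg 1 (by simp)))
  have hinj : Function.Injective (LinearMap.mulLeft K q) := mul_right_injective₀ hq0
  have hsup : degComp (J ⊔ Ideal.span {q}) (m + d) =
      degComp J (m + d) ⊔ (homogeneousSubmodule (Fin n) K d).map (LinearMap.mulLeft K q) := by
    apply le_antisymm
    · intro f hf
      obtain ⟨a, ha⟩ := mem_sup_span_singleton.1 hf.2
      have := homogeneousComponent_mem_of_mem hJ ha (m + d)
      rw [map_sub, homogeneousComponent_add_mul hq, homogeneousComponent_eq_self hf.1] at this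
      have ha' := homogeneousComponent_isHomogeneous d a
      refine Submodule.mem_sup.2 ⟨_, ⟨?_, this⟩, q * homogeneousComponent d a, ⟨_, ha', rfl⟩,
        by ring⟩
      exact IsHomogeneous.sub hf.1 (hq.mul ha')
    · refine sup_le (fun f hf => ⟨hf.1, (le_sup_left : J ≤ _) hf.2⟩) ?_
      rintro _ ⟨a, ha, rfl⟩
      exact ⟨hq.mul ha, (le_sup_right : _ ≤ J ⊔ _)
        (Ideal.mul_mem_right _ _ (Ideal.mem_span_singleton_self q))⟩
  have hinf : degComp J (m + d) ⊓
      (homogeneousSubmodule (Fin n) K d).map (LinearMap.mulLeft K q) =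
      (degComp J d).map (LinearMap.mulLeft K q) := by
    apply le_antisymm
    · rintro _ ⟨⟨-, h1⟩, a, ha, rfl⟩
      exact ⟨a, ⟨ha, hreg a h1⟩, rfl⟩
    · rintro _ ⟨a, ha, rfl⟩
      exact ⟨⟨hq.mul ha.1, J.mul_mem_left _ ha.2⟩, a, ha.1, rfl⟩
  have := Submodule.finrank_sup_add_finrank_inf_eq (degComp J (m + d))
    ((homogeneousSubmodule (Fin n) K d).map (LinearMap.mulLeft K q))
  rwa [← hsup, hinf, ← (Submodule.equivMapOfInjective _ hinj _).finrank_eq,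
    ← (Submodule.equivMapOfInjective _ hinj _).finrank_eq] at this

/-- Induction with `finrank_degComp_sup`. `RegMod` does not exclude the unit ideal, so the common
bound `Q ≠ ⊤` keeps every ideal in the chains proper. -/
theorem RegChain.finrank_degComp_eq {Q : Ideal (MvPolynomial (Fin n) K)} (hQ : Q ≠ ⊤)
    {V : Set (MvPolynomial (Fin n) K)}
    (hV : ∀ q ∈ V, q.IsHomogeneous m) (hVQ : V ⊆ Q) {k : ℕ} :
    ∀ {J₁ J₂ J₁' J₂' : Ideal (MvPolynomial (Fin n) K)},
      J₁.IsHomogeneous (homogeneousSubmodule (Fin n) K) →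
      J₂.IsHomogeneous (homogeneousSubmodule (Fin n) K) → J₁ ≤ Q → J₂ ≤ Q →
      (∀ d, Module.finrank K (degComp J₁ d) = Module.finrank K (degComp J₂ d)) →
      RegChain V k J₁ J₁' → RegChain V k J₂ J₂' →
      ∀ d, Module.finrank K (degComp J₁' d) = Module.finrank K (degComp J₂' d) := by
  induction k with
  | zero =>
    intro J₁ J₂ J₁' J₂' _ _ _ _ h h₁ h₂
    cases h₁
    cases h₂
    exact h
  | succ k ih =>
    intro J₁ J₂ J₁' J₂' hJ₁ hJ₂ hQ₁ hQ₂ h h₁ h₂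
    cases h₁ with
    | @cons _ _ _ x hxV hx h₁ =>
    cases h₂ with
    | @cons _ _ _ y hyV hy h₂ =>
    refine ih (hJ₁.sup (isHomogeneous_span_singleton (hV x hxV)))
      (hJ₂.sup (isHomogeneous_span_singleton (hV y hyV)))
      (sup_le hQ₁ ((Ideal.span_singleton_le_iff_mem _).2 (hVQ hxV)))
      (sup_le hQ₂ ((Ideal.span_singleton_le_iff_mem _).2 (hVQ hyV))) (fun d => ?_) h₁ h₂
    rcases lt_or_ge d m with hd | hd
    · rw [degComp_sup_of_lt hJ₁ (hV x hxV) hd, degComp_sup_of_lt hJ₂ (hV y hyV) hd, h]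
    · obtain ⟨d, rfl⟩ := Nat.exists_eq_add_of_le hd
      have e₁ := finrank_degComp_sup hJ₁ (fun h => hQ (top_le_iff.1 (h ▸ hQ₁))) (hV x hxV) hx d
      have e₂ := finrank_degComp_sup hJ₂ (fun h => hQ (top_le_iff.1 (h ▸ hQ₂))) (hV y hyV) hy d
      have := h d
      have := h (m + d)
      omega

/-- The ideal generated by the `m`-th powers of the variables with index in `s`. -/
noncomputable def powIdeal (K : Type*) [Field K] (m : ℕ) (s : Finset (Fin n)) :
    Ideal (MvPolynomial (Fin n) K) :=
  Ideal.span ((fun i => (X i : MvPolynomial (Fin n) K) ^ m) '' s)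

theorem mem_powIdeal {s : Finset (Fin n)} {f : MvPolynomial (Fin n) K} :
    f ∈ powIdeal K m s ↔ ∀ d ∈ f.support, ∃ i ∈ s, m ≤ d i := by
  have : powIdeal K m s = Ideal.span ((fun d => monomial d (1 : K)) ''
      ((fun i => Finsupp.single i m) '' (s : Set (Fin n)))) := by
    rw [powIdeal, Set.image_image]
    simp only [X_pow_eq_monomial]
  rw [this, mem_ideal_span_monomial_image]
  simp

theorem powIdeal_insert {s : Finset (Fin n)} (i : Fin n) :
    powIdeal K m (insert i s) = powIdeal K m s ⊔ Ideal.span {X i ^ m} := by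
  rw [powIdeal, powIdeal, Finset.coe_insert, Set.image_insert_eq, Ideal.span_insert, sup_comm]

/-- Multiplying by `X i ^ m` changes only the `i`-th exponent, so an exponent `≥ m` at an index of
`s` was already there. -/
theorem regMod_powIdeal {s : Finset (Fin n)} {i : Fin n} (hi : i ∉ s) :
    RegMod (powIdeal K m s) (X i ^ m : MvPolynomial (Fin n) K) := by
  intro u hu
  rw [mem_powIdeal] at hu ⊢
  intro d hd
  obtain ⟨j, hj, hmj⟩ := hu (Finsupp.single i m + d) (by
    rw [X_pow_eq_monomial, mem_support_iff, coeff_monomial_mul, one_mul]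
    exact mem_support_iff.1 hd)
  refine ⟨j, hj, ?_⟩
  have hij : i ≠ j := fun h => hi (h ▸ hj)
  simpa [Finsupp.single_apply, hij] using hmj

theorem regChain_powIdeal (k : ℕ) : ∀ s : Finset (Fin n), s.card + k = n →
    RegChain (Set.range fun i => (X i : MvPolynomial (Fin n) K) ^ m) k (powIdeal K m s)
      (powIdeal K m Finset.univ) := by
  induction k with
  | zero =>
    intro s hs
    have : s = Finset.univ := (Finset.card_eq_iff_eq_univ s).1 (by simpa using hs)
    rw [this]
    exact .nil _
  | succ k ih =>
    intro s hs
    obtain ⟨i, hi⟩ : ∃ i, i ∉ s := by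
      by_contra! h
      have := (Finset.card_eq_iff_eq_univ s).2 (Finset.eq_univ_of_forall h)
      simp at this
      omega
    refine .cons ⟨i, rfl⟩ (regMod_powIdeal hi) ?_
    rw [← powIdeal_insert]
    exact ih _ (by rw [Finset.card_insert_of_notMem hi]; omega)

theorem powIdeal_empty : powIdeal K m (∅ : Finset (Fin n)) = ⊥ := by simp [powIdeal]

theorem mem_idealOfVars_iff {f : MvPolynomial (Fin n) K} :
    f ∈ idealOfVars (Fin n) K ↔ constantCoeff f = 0 := by
  have := mem_pow_idealOfVars_iff' 1 f
  rw [pow_one] at this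
  rw [this]
  simp [constantCoeff_eq, Finsupp.degree_eq_zero_iff]

theorem isMaximal_idealOfVars : (idealOfVars (Fin n) K).IsMaximal := by
  have h : idealOfVars (Fin n) K = RingHom.ker (constantCoeff : MvPolynomial (Fin n) K →+* K) :=
    Ideal.ext fun f => by rw [mem_idealOfVars_iff, RingHom.mem_ker]
  rw [h]
  exact RingHom.ker_isMaximal_of_surjective _ fun a => ⟨C a, by simp⟩

theorem mem_pow_idealOfVars_of_isHomogeneous {f : MvPolynomial (Fin n) K} {d : ℕ}
    (hf : f.IsHomogeneous d) : f ∈ idealOfVars (Fin n) K ^ d := by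
  rw [mem_pow_idealOfVars_iff']
  exact fun x hx => hf.coeff_eq_zero hx.ne

theorem isHomogeneous_span_range {ι : Type*} {p : ι → MvPolynomial (Fin n) K}
    (hp : ∀ r, (p r).IsHomogeneous m) :
    (Ideal.span (Set.range p)).IsHomogeneous (homogeneousSubmodule (Fin n) K) := by
  refine Ideal.homogeneous_span _ _ ?_
  rintro _ ⟨r, rfl⟩
  exact ⟨m, hp r⟩

theorem degComp_span_range {ι : Type*} [Finite ι] {p : ι → MvPolynomial (Fin n) K}
    (hp : ∀ r, (p r).IsHomogeneous m) :
    degComp (Ideal.span (Set.range p)) m = Submodule.span K (Set.range p) := by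
  cases nonempty_fintype ι
  apply le_antisymm
  · intro f hf
    obtain ⟨c, hc⟩ := Ideal.mem_span_range_iff_exists_fun.1 hf.2
    have h := homogeneousComponent_eq_self hf.1
    rw [← hc, map_sum] at h
    have hr : ∀ r, homogeneousComponent m (c r * p r) = constantCoeff (c r) • p r := by
      intro r
      have := homogeneousComponent_add_mul (hp r) (c r) 0
      rw [add_zero, homogeneousComponent_zero] at this
      rw [mul_comm, this, mul_comm, smul_eq_C_mul, constantCoeff_eq]
    rw [hc] at h
    simp only [hr] at h
    rw [← h]
    exact Submodule.sum_mem _ fun r _ => Submodule.smul_mem _ _ (Submodule.subset_span ⟨r, rfl⟩)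
  · rw [Submodule.span_le]
    rintro _ ⟨r, rfl⟩
    exact ⟨hp r, Ideal.subset_span ⟨r, rfl⟩⟩

/-- Pigeonhole: if all `n` exponents are at most `m - 1`, the degree is at most `n * (m - 1)`. -/
theorem degComp_powIdeal_of_lt (hm : 1 ≤ m) {d : ℕ} (hd : n * (m - 1) < d) :
    degComp (powIdeal K m (Finset.univ : Finset (Fin n))) d =
      homogeneousSubmodule (Fin n) K d := by
  refine inf_eq_left.2 fun f hf => ?_
  refine mem_powIdeal.2 fun x hx => ?_
  by_contra! h
  have hdeg : x.degree = d := by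
    by_contra hne
    exact mem_support_iff.1 hx (IsHomogeneous.coeff_eq_zero hf hne)
  rw [Finsupp.degree_eq_sum] at hdeg
  have := Finset.sum_le_card_nsmul Finset.univ (fun i => x i) (m - 1)
    fun i hi => by have := h i hi; omega
  simp at this
  omega

theorem degComp_powIdeal_ne (hm : 1 ≤ m) :
    degComp (powIdeal K m (Finset.univ : Finset (Fin n))) (n * (m - 1)) ≠
      homogeneousSubmodule (Fin n) K (n * (m - 1)) := by
  intro h
  let x : Fin n →₀ ℕ := Finsupp.equivFunOnFinite.symm fun _ => m - 1
  have hx : (monomial x (1 : K)).IsHomogeneous (n * (m - 1)) :=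
    isHomogeneous_monomial _ (by simp [x, Finsupp.degree_eq_sum])
  have hx' : monomial x (1 : K) ∈ degComp (powIdeal K m Finset.univ) (n * (m - 1)) := by
    rw [h]; exact hx
  obtain ⟨i, -, hi⟩ := mem_powIdeal.1 hx'.2 x (by simp)
  simp [x] at hi
  omega

theorem card_le_finrank_degComp_powIdeal (hm : 1 ≤ m) :
    n ≤ Module.finrank K (degComp (powIdeal K m (Finset.univ : Finset (Fin n))) m) := by
  have hli : LinearIndependent K fun i : Fin n => (X i : MvPolynomial (Fin n) K) ^ m := by
    have := (basisMonomials (Fin n) K).linearIndependent.comp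
      (fun i : Fin n => Finsupp.single i m) (Finsupp.single_left_injective (by omega))
    simpa [Function.comp_def, X_pow_eq_monomial] using this
  have h1 := linearIndependent_iff_card_le_finrank_span.1 hli
  rw [Fintype.card_fin] at h1
  refine h1.trans (Submodule.finrank_mono ?_)
  rw [Submodule.span_le]
  rintro _ ⟨i, rfl⟩
  exact ⟨isHomogeneous_X_pow i m, Ideal.subset_span ⟨i, by simp, rfl⟩⟩

/-- A system of parameters of `n` forms of degree `m` has the Hilbert function of
`(X₁ᵐ, …, Xₙᵐ)` and is linearly independent. -/
theorem linearIndependent_and_finrank_degComp [Infinite K] (hm : 1 ≤ m)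
    {p : Fin n → MvPolynomial (Fin n) K}
    (hp : ∀ r, (p r).IsHomogeneous m) {N : ℕ}
    (hN : idealOfVars (Fin n) K ^ N ≤ Ideal.span (Set.range p)) :
    LinearIndependent K p ∧ ∀ d, Module.finrank K (degComp (Ideal.span (Set.range p)) d) =
      Module.finrank K (degComp (powIdeal K m (Finset.univ : Finset (Fin n))) d) := by
  have hM := isMaximal_idealOfVars (n := n) (K := K)
  set P := Ideal.span (Set.range p) with hP
  set V : Submodule K (MvPolynomial (Fin n) K) := Submodule.span K (Set.range p) with hV
  let W : Set (MvPolynomial (Fin n) K) := homogeneousSubmodule (Fin n) K m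
  have hWM : W ⊆ idealOfVars (Fin n) K := fun f hf =>
    Ideal.pow_le_self (by omega) (mem_pow_idealOfVars_of_isHomogeneous hf)
  have hVW : (V : Set (MvPolynomial (Fin n) K)) ⊆ W := by
    rw [← degComp_span_range hp] at hV
    rw [hV]
    exact fun f hf => hf.1
  have hVP : (V : Set (MvPolynomial (Fin n) K)) ⊆ P := by
    rw [← degComp_span_range hp] at hV
    rw [hV]
    exact fun f hf => hf.2
  have hX := regChain_powIdeal (K := K) (m := m) n (∅ : Finset (Fin n)) (by simp)
  rw [powIdeal_empty] at hX
  have hXW := hX.mono (W := W) (by rintro _ ⟨i, rfl⟩; exact isHomogeneous_X_pow i m)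
  -- Only the length of the sequence of powers `X i ^ m` is used here: it provides a regular
  -- sequence of `n` elements in the span of the `p r`.
  obtain ⟨J, hJ⟩ := (hXW.mono hWM).exists_in_subspace hM V
    (hN.trans (Ideal.span_mono Submodule.subset_span)) (hVW.trans hWM)
  have hJP : J ≤ P := hJ.le_of_le hVP bot_le
  have hdim := RegChain.finrank_degComp_eq hM.ne_top (V := W) (fun _ h => h) hWM
    (Ideal.IsHomogeneous.bot _) (Ideal.IsHomogeneous.bot _) bot_le bot_le (fun _ => rfl)
    (hJ.mono hVW) hXW
  have hle : degComp J m ≤ V := by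
    rw [hV, ← degComp_span_range hp]
    exact fun f hf => ⟨hf.1, hJP hf.2⟩
  have hn : n ≤ Module.finrank K (degComp J m) := by
    rw [hdim]; exact card_le_finrank_degComp_powIdeal hm
  have hVn : Module.finrank K V ≤ n := by
    have := finrank_range_le_card (R := K) p
    rwa [Fintype.card_fin] at this
  have : Module.Finite K V := .span_of_finite K (Set.finite_range p)
  -- The degree `m` part of `J` lies in `V`, has dimension at least `n` by comparison with the
  -- powers `X i ^ m`, and `V` is spanned by `n` vectors.
  have hJV : degComp J m = V := Submodule.eq_of_le_of_finrank_le hle (hVn.trans hn)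
  have hPJ : P ≤ J := Ideal.span_le.2 (by
    rintro _ ⟨r, rfl⟩
    have : p r ∈ degComp J m := by rw [hJV]; exact Submodule.subset_span ⟨r, rfl⟩
    exact this.2)
  refine ⟨linearIndependent_iff_card_le_finrank_span.2 ?_, fun d => ?_⟩
  · rw [Fintype.card_fin]
    exact hn.trans (Submodule.finrank_mono hle)
  · rw [← hdim, le_antisymm hPJ hJP]

theorem isHomogeneous_mem_span_range [Infinite K] (hm : 1 ≤ m)
    {p : Fin n → MvPolynomial (Fin n) K} (hp : ∀ r, (p r).IsHomogeneous m) {N : ℕ}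
    (hN : idealOfVars (Fin n) K ^ N ≤ Ideal.span (Set.range p)) {d : ℕ} (hd : n * (m - 1) < d)
    {f : MvPolynomial (Fin n) K} (hf : f.IsHomogeneous d) : f ∈ Ideal.span (Set.range p) := by
  have h := (linearIndependent_and_finrank_degComp hm hp hN).2 d
  rw [degComp_powIdeal_of_lt hm hd] at h
  have : degComp (Ideal.span (Set.range p)) d = homogeneousSubmodule (Fin n) K d :=
    Submodule.eq_of_le_of_finrank_eq inf_le_left h
  have hf' : f ∈ degComp (Ideal.span (Set.range p)) d := by rw [this]; exact hf
  exact hf'.2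

theorem exists_isHomogeneous_notMem_span_range [Infinite K] (hm : 1 ≤ m)
    {p : Fin n → MvPolynomial (Fin n) K} (hp : ∀ r, (p r).IsHomogeneous m) {N : ℕ}
    (hN : idealOfVars (Fin n) K ^ N ≤ Ideal.span (Set.range p)) :
    ∃ f : MvPolynomial (Fin n) K, f.IsHomogeneous (n * (m - 1)) ∧
      f ∉ Ideal.span (Set.range p) := by
  by_contra! hcon
  have h := (linearIndependent_and_finrank_degComp hm hp hN).2 (n * (m - 1))
  have : degComp (Ideal.span (Set.range p)) (n * (m - 1)) = homogeneousSubmodule (Fin n) K _ :=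
    inf_eq_left.2 fun f hf => hcon f hf
  rw [this] at h
  exact degComp_powIdeal_ne hm (Submodule.eq_of_le_of_finrank_eq inf_le_left h.symm)

end HilbertFunction
-- From germs of holomorphic functions to polynomials.
section Germs

open MvPolynomial

variable {n : ℕ}

/-- The homomorphism sending a polynomial to its function. -/
noncomputable def polyFun (n : ℕ) : MvPolynomial (Fin n) ℂ →ₐ[ℂ] holoAtZero n where
  toFun p := ⟨fun z => eval z p, AnalyticOnNhd.eval_mvPolynomial p 0 (Set.mem_univ _)⟩
  map_one' := Subtype.ext (funext fun z => by simp)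
  map_mul' a b := Subtype.ext (funext fun z => by simp)
  map_zero' := Subtype.ext (funext fun z => by simp)
  map_add' a b := Subtype.ext (funext fun z => by simp)
  commutes' c := Subtype.ext (funext fun z => by simp [algebraMap_eq])

/-- The homomorphism sending a polynomial to the class of its germ. -/
noncomputable def toGermAlg (p : Fin n → MvPolynomial (Fin n) ℂ) :
    MvPolynomial (Fin n) ℂ →ₐ[ℂ] GermAlg p :=
  ((Ideal.Quotient.mkₐ ℂ (germIdeal p)).comp (Ideal.Quotient.mkₐ ℂ (zeroGerms n))).comp (polyFun n)

theorem toGermAlg_apply (p : Fin n → MvPolynomial (Fin n) ℂ) (f : MvPolynomial (Fin n) ℂ) :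
    toGermAlg p f = Ideal.Quotient.mk (germIdeal p) (polyGerm f) := rfl

/-- A multilinear form evaluated on the diagonal is a polynomial. -/
theorem exists_eval_eq_multilinear {k : ℕ}
    (L : MultilinearMap ℂ (fun _ : Fin k => Fin n → ℂ) ℂ) :
    ∃ T : MvPolynomial (Fin n) ℂ, ∀ z, eval z T = L fun _ => z := by
  classical
  refine ⟨∑ s : Fin k → Fin n, (∏ j, X (s j)) * C (L fun j => Pi.single (s j) 1), fun z => ?_⟩
  have hz : z = ∑ i, z i • Pi.single i (1 : ℂ) := by
    funext j; simp [Finset.sum_apply, Pi.single_apply]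
  conv_rhs => rw [hz, MultilinearMap.map_sum]
  simp [MultilinearMap.map_smul_univ, map_sum, map_prod]

theorem exists_taylor {g : (Fin n → ℂ) → ℂ} (hg : AnalyticAt ℂ g 0) (k : ℕ) :
    ∃ T : MvPolynomial (Fin n) ℂ,
      (fun z => g z - eval z T) =O[𝓝 0] fun z => ‖z‖ ^ k := by
  obtain ⟨F, hF⟩ := hg
  choose T hT using fun j => exists_eval_eq_multilinear (F j).toMultilinearMap
  refine ⟨∑ j ∈ Finset.range k, T j, ?_⟩
  have := hF.isBigO_sub_partialSum_pow k
  simpa [FormalMultilinearSeries.partialSum, hT] using this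

/-- Hadamard's lemma for germs of holomorphic functions. -/
theorem exists_hadamard {g : (Fin n → ℂ) → ℂ} (hg : AnalyticAt ℂ g 0) :
    ∃ G : Fin n → (Fin n → ℂ) → ℂ, (∀ i, AnalyticAt ℂ (G i) 0) ∧
      ∀ᶠ z in 𝓝 (0 : Fin n → ℂ), g z = g 0 + ∑ i, z i * G i z := by
  obtain ⟨F, r, hF⟩ := hg
  -- The shifted series sums to an analytic family of linear functionals `L z` with `g z = g 0 + L z
  -- z`; the `G i z` are the values of `L z` on the standard basis.
  have hrad : 0 < F.shift.radius := by
    rw [FormalMultilinearSeries.radius_shift]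
    exact hF.r_pos.trans_le hF.r_le
  have hS := F.shift.hasFPowerSeriesOnBall hrad
  refine ⟨fun i z => F.shift.sum z (Pi.single i 1), fun i => ?_, ?_⟩
  · exact (ContinuousLinearMap.apply ℂ ℂ (Pi.single i (1 : ℂ))).analyticAt _ |>.comp hS.analyticAt
  · have hball : Metric.eball (0 : Fin n → ℂ) r ∈ 𝓝 0 := Metric.eball_mem_nhds _ hF.r_pos
    have hball' : Metric.eball (0 : Fin n → ℂ) F.shift.radius ∈ 𝓝 0 :=
      Metric.eball_mem_nhds _ hrad
    filter_upwards [hball, hball'] with z hz hz'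
    have h1 := hF.hasSum hz
    have h2 := (ContinuousLinearMap.apply ℂ ℂ z).hasSum (hS.hasSum hz')
    rw [zero_add] at h1 h2
    have h3 : HasSum (fun k => F (k + 1) fun _ => z) (F.shift.sum z z) := by
      have e : (fun k => F (k + 1) fun _ => z) = fun k => F.shift k (fun _ => z) z := by
        funext k
        rw [FormalMultilinearSeries.shift, ContinuousMultilinearMap.curryRight_apply]
        congr 1
        funext j
        refine Fin.lastCases ?_ (fun j => ?_) j <;> simp
      rw [e]
      exact h2
    have h4 := h1.unique h3.zero_add
    rw [hF.coeff_zero] at h4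
    rw [h4]
    congr 1
    have hz : z = ∑ i, z i • Pi.single i (1 : ℂ) := by
      funext j; simp [Finset.sum_apply, Pi.single_apply]
    have h5 := congrArg (F.shift.sum z) hz
    rw [map_sum] at h5
    rw [h5]
    exact Finset.sum_congr rfl fun i _ => by rw [map_smul, smul_eq_mul]

/-- If the order `r` of vanishing at 0 were below `k`, the quotient by `t ^ r` would tend both to 0
and to a nonzero value. -/
theorem X_pow_dvd_of_isBigO {g : Polynomial ℂ} {k : ℕ}
    (hg : (fun t => g.eval t) =O[𝓝 0] fun t : ℂ => t ^ k) : Polynomial.X ^ k ∣ g := by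
  by_cases h0 : g = 0
  · simp [h0]
  obtain ⟨h, hgh, hh⟩ := g.exists_eq_pow_rootMultiplicity_mul_and_not_dvd h0 0
  set r := g.rootMultiplicity 0
  rw [Polynomial.C_0, sub_zero] at hgh hh
  rcases le_or_gt k r with hkr | hkr
  · rw [hgh]
    exact (pow_dvd_pow _ hkr).mul_right _
  · exfalso
    apply hh
    rw [Polynomial.X_dvd_iff, Polynomial.coeff_zero_eq_eval_zero]
    have h1 : (fun t => g.eval t) =o[𝓝 0] fun t : ℂ => t ^ r :=
      hg.trans_isLittleO (Asymptotics.isLittleO_pow_pow hkr)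
    have h2 : Filter.Tendsto (fun t => g.eval t / t ^ r) (𝓝[≠] 0) (𝓝 0) :=
      h1.tendsto_div_nhds_zero.mono_left nhdsWithin_le_nhds
    have h3 : Filter.Tendsto (fun t => h.eval t) (𝓝[≠] 0) (𝓝 (h.eval 0)) :=
      h.continuous.continuousAt.tendsto.mono_left nhdsWithin_le_nhds
    refine tendsto_nhds_unique (h3.congr' ?_) h2
    filter_upwards [self_mem_nhdsWithin] with t ht
    rw [hgh, Polynomial.eval_mul, Polynomial.eval_pow, Polynomial.eval_X,
      mul_div_cancel_left₀ _ (pow_ne_zero r ht)]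

theorem eval_smul_of_isHomogeneous {h : MvPolynomial (Fin n) ℂ} {d : ℕ} (hh : h.IsHomogeneous d)
    (t : ℂ) (z : Fin n → ℂ) : eval (t • z) h = t ^ d * eval z h := by
  rw [eval_eq, eval_eq, Finset.mul_sum]
  refine Finset.sum_congr rfl fun x hx => ?_
  have hdeg : ∑ i ∈ x.support, x i = d := (hh.degree_eq_sum_deg_support hx).symm
  simp only [Pi.smul_apply, smul_eq_mul, mul_pow, Finset.prod_mul_distrib,
    Finset.prod_pow_eq_pow_sum, hdeg]
  ring

/-- On each line `t ↦ t • z` the coefficient of `t ^ d` is the value at `z` of the degree `d`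
component, which reduces the claim to one variable. -/
theorem homogeneousComponent_eq_zero_of_isBigO {h : MvPolynomial (Fin n) ℂ} {k : ℕ}
    (hh : (fun z => eval z h) =O[𝓝 0] fun z => ‖z‖ ^ k) {d : ℕ} (hd : d < k) :
    homogeneousComponent d h = 0 := by
  refine IsHomogeneous.eq_zero_of_forall_eval_eq_zero (homogeneousComponent_isHomogeneous d h)
    fun z => ?_
  let g : Polynomial ℂ := ∑ j ∈ Finset.range (h.totalDegree + 1),
    Polynomial.C (eval z (homogeneousComponent j h)) * Polynomial.X ^ j
  have hg : ∀ t, g.eval t = eval (t • z) h := by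
    intro t
    conv_rhs => rw [← sum_homogeneousComponent h, map_sum]
    rw [Polynomial.eval_finsetSum]
    refine Finset.sum_congr rfl fun j _ => ?_
    rw [eval_smul_of_isHomogeneous (homogeneousComponent_isHomogeneous j h)]
    rw [Polynomial.eval_mul, Polynomial.eval_C, Polynomial.eval_pow, Polynomial.eval_X, mul_comm]
  have hgd : g.coeff d = eval z (homogeneousComponent d h) := by
    simp only [g, Polynomial.finsetSum_coeff, Polynomial.coeff_C_mul, Polynomial.coeff_X_pow,
      mul_ite, mul_one, mul_zero, Finset.sum_ite_eq, Finset.mem_range]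
    split_ifs with hlt
    · rfl
    · rw [homogeneousComponent_eq_zero d h (by omega), map_zero]
  rw [← hgd]
  refine Polynomial.X_pow_dvd_iff.1 (X_pow_dvd_of_isBigO ?_) d hd
  have ht : Filter.Tendsto (fun t : ℂ => t • z) (𝓝 0) (𝓝 0) := by
    have : Continuous fun t : ℂ => t • z := by fun_prop
    simpa using this.tendsto 0
  have h1 := hh.comp_tendsto ht
  simp only [Function.comp_def, ← hg] at h1
  refine h1.trans ?_
  simp only [norm_smul, mul_pow]
  refine Asymptotics.IsBigO.of_bound (‖z‖ ^ k) (Filter.Eventually.of_forall fun t => ?_)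
  rw [Real.norm_of_nonneg (by positivity), norm_pow, mul_comm]

/-- The kernel of the map from polynomials to `𝒪ₙ / (p₁, …, pₙ)` is generated by the forms
`p₁, …, pₙ` already among polynomials. -/
theorem ker_toGermAlg {m : ℕ} {p : Fin n → MvPolynomial (Fin n) ℂ}
    (hp : ∀ r, (p r).IsHomogeneous m) :
    RingHom.ker (toGermAlg p) = Ideal.span (Set.range p) := by
  apply le_antisymm
  · intro f hf
    rw [RingHom.mem_ker, toGermAlg_apply] at hf
    have hf' : polyGerm f ∈ germIdeal p := Ideal.Quotient.eq_zero_iff_mem.1 hf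
    obtain ⟨c, hc⟩ := Ideal.mem_span_range_iff_exists_fun.1 hf'
    choose G hG using fun r => Ideal.Quotient.mk_surjective (c r)
    have hev : ∀ᶠ z in 𝓝 (0 : Fin n → ℂ), ∑ r, (G r).1 z * eval z (p r) = eval z f := by
      have h0 : ∑ r, G r * polyFun n (p r) - polyFun n f ∈ zeroGerms n := by
        rw [← Ideal.Quotient.eq_zero_iff_mem, map_sub, map_sum, sub_eq_zero]
        simp only [map_mul, hG]
        exact hc
      filter_upwards [h0] with z hz
      have : (∑ r, G r * polyFun n (p r) - polyFun n f).1 z =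
          ∑ r, (G r).1 z * eval z (p r) - eval z f := by
        simp [polyFun, Finset.sum_apply]
      rw [this] at hz
      exact sub_eq_zero.1 hz
    -- Taylor polynomials beyond the degree of `f` suffice: the error cannot affect any component of
    -- `f`, and `P` is homogeneous.
    choose T hT using fun r => exists_taylor (G r).2 (f.totalDegree + 1)
    have hO : (fun z => eval z (f - ∑ r, T r * p r)) =O[𝓝 0]
        fun z => ‖z‖ ^ (f.totalDegree + 1) := by
      have h1 : (fun z => ∑ r, ((G r).1 z - eval z (T r)) * eval z (p r)) =O[𝓝 0]
          fun z => ‖z‖ ^ (f.totalDegree + 1) := by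
        refine Asymptotics.IsBigO.fun_sum fun r _ => ?_
        have hb : (fun z => eval z (p r)) =O[𝓝 (0 : Fin n → ℂ)] fun _ => (1 : ℝ) :=
          Filter.Tendsto.isBigO_one ℝ (c := eval 0 (p r))
            ((MvPolynomial.continuous_eval (p r)).tendsto 0)
        simpa using (hT r).mul hb
      refine h1.congr' ?_ Filter.EventuallyEq.rfl
      filter_upwards [hev] with z hz
      simp [sub_mul, Finset.sum_sub_distrib, hz]
    rw [← sum_homogeneousComponent f]
    refine Ideal.sum_mem _ fun d hd => ?_
    have h0 := homogeneousComponent_eq_zero_of_isBigO hO (Finset.mem_range.1 hd)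
    rw [map_sub, sub_eq_zero] at h0
    rw [h0]
    exact homogeneousComponent_mem_of_mem (isHomogeneous_span_range hp)
      (Ideal.sum_mem _ fun r _ => Ideal.mul_mem_left _ _ (Ideal.subset_span ⟨r, rfl⟩)) d
  · rw [Ideal.span_le]
    rintro _ ⟨r, rfl⟩
    rw [SetLike.mem_coe, RingHom.mem_ker, toGermAlg_apply]
    exact Ideal.Quotient.eq_zero_iff_mem.2 (Ideal.subset_span ⟨r, rfl⟩)

/-- In a finite-dimensional algebra the image of `X i` satisfies a monic equation; homogeneity of
the ideal isolates its leading term. -/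
theorem X_pow_mem_span_range {m : ℕ} {p : Fin n → MvPolynomial (Fin n) ℂ}
    (hp : ∀ r, (p r).IsHomogeneous m) [Module.Finite ℂ (GermAlg p)] (i : Fin n) :
    ∃ k, (X i : MvPolynomial (Fin n) ℂ) ^ k ∈ Ideal.span (Set.range p) := by
  obtain ⟨g, hg, hg0⟩ := Algebra.IsIntegral.isIntegral (R := ℂ) (toGermAlg p (X i))
  refine ⟨g.natDegree, ?_⟩
  have h1 : Polynomial.aeval (X i : MvPolynomial (Fin n) ℂ) g ∈ Ideal.span (Set.range p) := by
    rw [← ker_toGermAlg hp, RingHom.mem_ker]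
    rw [← Polynomial.aeval_def, Polynomial.aeval_algHom_apply] at hg0
    exact hg0
  have h2 := homogeneousComponent_mem_of_mem (isHomogeneous_span_range hp) h1 g.natDegree
  convert h2 using 1
  rw [Polynomial.aeval_eq_sum_range, map_sum, Finset.sum_eq_single g.natDegree]
  · rw [hg.coeff_natDegree, one_smul, homogeneousComponent_eq_self (isHomogeneous_X_pow i _)]
  · intro j _ hj
    rw [map_smul, homogeneousComponent_of_mem (isHomogeneous_X_pow i j), if_neg hj.symm, smul_zero]
  · simp

theorem exists_pow_idealOfVars_le {m : ℕ} {p : Fin n → MvPolynomial (Fin n) ℂ}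
    (hp : ∀ r, (p r).IsHomogeneous m) [Module.Finite ℂ (GermAlg p)] :
    ∃ N, idealOfVars (Fin n) ℂ ^ N ≤ Ideal.span (Set.range p) := by
  refine Ideal.exists_pow_le_of_le_radical_of_fg ?_ (idealOfVars_fg _ _)
  rw [Ideal.span_le]
  rintro _ ⟨i, rfl⟩
  exact X_pow_mem_span_range hp i

theorem toGermAlg_surjective {m : ℕ} {p : Fin n → MvPolynomial (Fin n) ℂ}
    (hp : ∀ r, (p r).IsHomogeneous m) [Module.Finite ℂ (GermAlg p)] :
    Function.Surjective (toGermAlg p) := by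
  let φ := toGermAlg p
  have hhad : ∀ b : GermAlg p, ∃ (c : ℂ) (b' : Fin n → GermAlg p),
      b = φ (C c) + ∑ i, φ (X i) * b' i := by
    intro b
    obtain ⟨b₁, rfl⟩ := Ideal.Quotient.mk_surjective b
    obtain ⟨g, rfl⟩ := Ideal.Quotient.mk_surjective b₁
    obtain ⟨G, hG, hgG⟩ := exists_hadamard g.2
    refine ⟨g.1 0, fun i => Ideal.Quotient.mk _ (Ideal.Quotient.mk _ ⟨G i, hG i⟩), ?_⟩
    let ψ : holoAtZero n →ₐ[ℂ] GermAlg p :=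
      (Ideal.Quotient.mkₐ ℂ (germIdeal p)).comp (Ideal.Quotient.mkₐ ℂ (zeroGerms n))
    let G' : Fin n → holoAtZero n := fun i => ⟨G i, hG i⟩
    have h0 : g - (polyFun n (C (g.1 0)) + ∑ i, polyFun n (X i) * G' i) ∈ zeroGerms n := by
      filter_upwards [hgG] with z hz
      have : (g - (polyFun n (C (g.1 0)) + ∑ i, polyFun n (X i) * G' i)).1 z =
          g.1 z - (g.1 0 + ∑ i, z i * G i z) := by
        simp [G', polyFun, Finset.sum_apply]
      rw [this, hz, sub_self]
    have h1 : ψ (g - (polyFun n (C (g.1 0)) + ∑ i, polyFun n (X i) * G' i)) = 0 :=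
      (congrArg (Ideal.Quotient.mk (germIdeal p)) (Ideal.Quotient.eq_zero_iff_mem.2 h0)).trans
        (map_zero _)
    rw [map_sub, sub_eq_zero, map_add, map_sum] at h1
    simp only [map_mul] at h1
    exact h1
  let : Algebra (MvPolynomial (Fin n) ℂ) (GermAlg p) := φ.toRingHom.toAlgebra
  let S : Submodule (MvPolynomial (Fin n) ℂ) (GermAlg p) :=
    LinearMap.range (Algebra.linearMap (MvPolynomial (Fin n) ℂ) (GermAlg p))
  -- Hadamard's lemma says that every element is a constant plus an element of `M` times the
  -- algebra. Iterating replaces `M` by `M ^ k`, and a high power of `M` acts as zero.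
  have hstep : ∀ k, (⊤ : Submodule (MvPolynomial (Fin n) ℂ) (GermAlg p)) ≤
      S ⊔ idealOfVars (Fin n) ℂ ^ k • ⊤ := by
    intro k
    induction k with
    | zero =>
      rw [pow_zero, Ideal.one_eq_top, Submodule.top_smul]
      exact le_sup_right
    | succ k ih =>
      have h1 : (⊤ : Submodule (MvPolynomial (Fin n) ℂ) (GermAlg p)) ≤
          S ⊔ idealOfVars (Fin n) ℂ • ⊤ := by
        intro b _
        obtain ⟨c, b', hb⟩ := hhad b
        rw [hb]
        refine Submodule.add_mem_sup ⟨C c, rfl⟩ (Submodule.sum_mem _ fun i _ => ?_)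
        exact Submodule.smul_mem_smul (Ideal.subset_span ⟨i, rfl⟩) (Submodule.mem_top (x := b' i))
      refine ih.trans (sup_le le_sup_left ?_)
      refine (smul_mono_right _ h1).trans ?_
      rw [Submodule.smul_sup, ← Submodule.mul_smul, ← pow_succ]
      exact sup_le_sup_right Submodule.smul_le_right _
  obtain ⟨N, hN⟩ := exists_pow_idealOfVars_le hp
  have hN' : idealOfVars (Fin n) ℂ ^ N • (⊤ : Submodule (MvPolynomial (Fin n) ℂ) (GermAlg p)) ≤
      S := by
    rw [Submodule.smul_le]
    intro f hf b _
    have : φ f = 0 := by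
      rw [← RingHom.mem_ker, ker_toGermAlg hp]
      exact hN hf
    have h2 : f • b = φ f * b := rfl
    rw [h2, this, zero_mul]
    exact zero_mem _
  intro b
  have := (hstep N).trans (sup_le le_rfl hN') (Submodule.mem_top (x := b))
  exact this

end Germs
-- Forms, coefficient vectors and linear substitutions.
section Forms

open MvPolynomial

variable {n : ℕ}

/-- The form of degree `m` with coefficient vector `γ`. -/
noncomputable def coeffForm {m : ℕ} (γ : MonoIdx n m → ℂ) : MvPolynomial (Fin n) ℂ :=
  ∑ ρ, γ ρ • mono ρ X

theorem mono_X_eq_monomial {m : ℕ} (ρ : MonoIdx n m) :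
    mono ρ (X : Fin n → MvPolynomial (Fin n) ℂ) =
      monomial (Finsupp.equivFunOnFinite.symm ρ.1) 1 := by
  rw [monomial_eq, map_one, one_mul, Finsupp.prod_fintype _ _ (by simp)]
  rfl

theorem sum_monoIdx {m : ℕ} (ρ : MonoIdx n m) : ∑ i, ρ.1 i = m :=
  (Finset.mem_piAntidiag.1 ρ.2).1

theorem isHomogeneous_coeffForm {m : ℕ} (γ : MonoIdx n m → ℂ) :
    (coeffForm γ).IsHomogeneous m := by
  refine IsHomogeneous.sum _ _ _ fun ρ _ => ?_
  rw [mono_X_eq_monomial, smul_monomial]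
  refine isHomogeneous_monomial _ ?_
  rw [Finsupp.degree_eq_sum]
  exact sum_monoIdx ρ

theorem linearIndependent_mono_X (m : ℕ) :
    LinearIndependent ℂ fun ρ : MonoIdx n m => mono ρ (X : Fin n → MvPolynomial (Fin n) ℂ) := by
  have := (basisMonomials (Fin n) ℂ).linearIndependent.comp
    (fun ρ : MonoIdx n m => Finsupp.equivFunOnFinite.symm ρ.1)
    (Finsupp.equivFunOnFinite.symm.injective.comp Subtype.val_injective)
  simpa only [Function.comp_def, coe_basisMonomials, ← mono_X_eq_monomial] using this

theorem exists_coeffForm_eq {m : ℕ} {f : MvPolynomial (Fin n) ℂ} (hf : f.IsHomogeneous m) :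
    ∃ γ : MonoIdx n m → ℂ, coeffForm γ = f := by
  suffices h : f ∈ Submodule.span ℂ
      (Set.range fun ρ : MonoIdx n m => mono ρ (X : Fin n → MvPolynomial (Fin n) ℂ)) from
    (Submodule.mem_span_range_iff_exists_fun ℂ).1 h
  rw [f.as_sum]
  refine Submodule.sum_mem _ fun d hd => ?_
  have hd' : ∑ i, d i = m := by
    rw [← Finsupp.degree_eq_sum]
    by_contra h
    exact mem_support_iff.1 hd (hf.coeff_eq_zero h)
  have : monomial d (coeff d f) = coeff d f • mono
      (⟨d, Finset.mem_piAntidiag.2 ⟨hd', by simp⟩⟩ : MonoIdx n m) X := by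
    rw [mono_X_eq_monomial, smul_monomial, smul_eq_mul, mul_one]
    congr 2
    ext i
    rfl
  rw [this]
  exact Submodule.smul_mem _ _ (Submodule.subset_span ⟨_, rfl⟩)

theorem aeval_coeffForm {m : ℕ} {B : Type*} [CommRing B] [Algebra ℂ B] (γ : MonoIdx n m → ℂ)
    (x : Fin n → B) : aeval x (coeffForm γ) = ∑ ρ, γ ρ • mono ρ x := by
  simp [coeffForm, mono]

theorem eval_coeffForm {m : ℕ} (Γ : Matrix (Fin n) (MonoIdx n m) ℂ) (z : Fin n → ℂ) (r : Fin n) :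
    eval z (coeffForm (Γ r)) = recMap Γ z r := by
  rw [← coe_aeval_eq_eval]
  exact aeval_coeffForm _ _

/-- The linear form with coefficient vector `c`. -/
noncomputable def linForm (c : Fin n → ℂ) : MvPolynomial (Fin n) ℂ := ∑ i, c i • X i

theorem isHomogeneous_linForm (c : Fin n → ℂ) : (linForm c).IsHomogeneous 1 :=
  IsHomogeneous.sum _ _ _ fun i _ => by
    rw [smul_eq_C_mul]; exact isHomogeneous_C_mul_X _ _

theorem coeff_linForm (c : Fin n → ℂ) (i : Fin n) :
    coeff (Finsupp.single i 1) (linForm c) = c i := by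
  classical
  simp [linForm, coeff_sum, coeff_X, Finsupp.single_left_inj]

theorem linForm_mem_sq {c : Fin n → ℂ} (h : linForm c ∈ idealOfVars (Fin n) ℂ ^ 2) : c = 0 := by
  funext i
  rw [mem_pow_idealOfVars_iff'] at h
  rw [← coeff_linForm c i]
  exact h _ (by simp)

theorem exists_sub_linForm_mem_sq {f : MvPolynomial (Fin n) ℂ}
    (hf : f ∈ idealOfVars (Fin n) ℂ) : ∃ c, f - linForm c ∈ idealOfVars (Fin n) ℂ ^ 2 := by
  have h1 := homogeneousComponent_mem 1 f
  rw [homogeneousSubmodule_one_eq_span_X, Submodule.mem_span_range_iff_exists_fun] at h1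
  obtain ⟨c, hc⟩ := h1
  refine ⟨c, ?_⟩
  rw [linForm, hc, mem_pow_idealOfVars_iff']
  intro x hx
  rw [coeff_sub, coeff_homogeneousComponent]
  split_ifs with h
  · exact sub_self _
  · have hx0 : x = 0 := by rw [← Finsupp.degree_eq_zero_iff]; omega
    rw [mem_idealOfVars_iff, constantCoeff_eq] at hf
    rw [hx0, hf, sub_zero]

/-- Linear substitution of variables. -/
noncomputable def linSubst (c : Matrix (Fin n) (Fin n) ℂ) :
    MvPolynomial (Fin n) ℂ →ₐ[ℂ] MvPolynomial (Fin n) ℂ :=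
  aeval fun i => linForm (c i)

theorem linSubst_linSubst (c d : Matrix (Fin n) (Fin n) ℂ) (f : MvPolynomial (Fin n) ℂ) :
    linSubst c (linSubst d f) = linSubst (d * c) f := by
  suffices (linSubst c).comp (linSubst d) = linSubst (d * c) from DFunLike.congr_fun this f
  ext1 i
  simp only [linSubst, AlgHom.comp_apply, aeval_X, linForm, map_sum, map_smul, Matrix.mul_apply,
    Finset.sum_smul, Finset.smul_sum, smul_smul]
  exact Finset.sum_comm

theorem linSubst_one (f : MvPolynomial (Fin n) ℂ) : linSubst 1 f = f := by
  suffices linSubst 1 = AlgHom.id ℂ (MvPolynomial (Fin n) ℂ) from DFunLike.congr_fun this f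
  ext1 i
  simp [linSubst, linForm, Matrix.one_apply]

theorem isHomogeneous_linSubst {m : ℕ} (c : Matrix (Fin n) (Fin n) ℂ)
    {f : MvPolynomial (Fin n) ℂ} (hf : f.IsHomogeneous m) : (linSubst c f).IsHomogeneous m := by
  have := hf.aeval (fun i => linForm (c i)) fun i => isHomogeneous_linForm (c i)
  rwa [one_mul] at this

theorem eval_linSubst (c : Matrix (Fin n) (Fin n) ℂ) (f : MvPolynomial (Fin n) ℂ)
    (z : Fin n → ℂ) : eval z (linSubst c f) = eval (c.mulVec z) f := by
  have h : (aeval z).comp (linSubst c) = aeval (R := ℂ) (c.mulVec z) := by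
    ext1 i
    simp [linSubst, linForm, Matrix.mulVec, dotProduct]
  exact DFunLike.congr_fun h f

end Forms

/-! ### Monomials modulo powers of an ideal. -/

section Congruence

variable {B : Type*} [CommRing B]

theorem mul_sub_mul_mem {I : Ideal B} {k l : ℕ} {a b a' b' : B} (hb : b ∈ I ^ k)
    (hab : a - b ∈ I ^ (k + 1)) (ha' : a' ∈ I ^ l) (hab' : a' - b' ∈ I ^ (l + 1)) :
    a * a' - b * b' ∈ I ^ (k + l + 1) := by
  have h : a * a' - b * b' = (a - b) * a' + b * (a' - b') := by ring
  rw [h]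
  refine Ideal.add_mem _ ?_ ?_
  · rw [add_right_comm, pow_add]; exact Ideal.mul_mem_mul hab ha'
  · rw [add_assoc, pow_add]; exact Ideal.mul_mem_mul hb hab'

theorem pow_sub_pow_mem {I : Ideal B} {a b : B} (ha : a ∈ I) (hb : b ∈ I) (hab : a - b ∈ I ^ 2)
    (k : ℕ) : a ^ k - b ^ k ∈ I ^ (k + 1) := by
  induction k with
  | zero => simp
  | succ k ih =>
    rw [pow_succ a, pow_succ b]
    exact mul_sub_mul_mem (l := 1) (Ideal.pow_mem_pow hb k) ih (by rwa [pow_one]) hab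

theorem prod_pow_sub_prod_pow_mem {ι : Type*} {I : Ideal B} {a b : ι → B} (ha : ∀ i, a i ∈ I)
    (hb : ∀ i, b i ∈ I) (hab : ∀ i, a i - b i ∈ I ^ 2) (k : ι → ℕ) (s : Finset ι) :
    ∏ i ∈ s, a i ^ k i - ∏ i ∈ s, b i ^ k i ∈ I ^ (∑ i ∈ s, k i + 1) := by
  classical
  induction s using Finset.induction_on with
  | empty => simp
  | insert i s hi ih =>
    rw [Finset.prod_insert hi, Finset.prod_insert hi, Finset.sum_insert hi]
    refine mul_sub_mul_mem (Ideal.pow_mem_pow (hb i) _)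
      (pow_sub_pow_mem (ha i) (hb i) (hab i) _) ?_ ih
    rw [← Finset.prod_pow_eq_pow_sum]
    exact Ideal.prod_mem_prod fun j _ => Ideal.pow_mem_pow (ha j) _

/-- This makes the class of a degree `m` monomial depend only on the linear parts of its arguments.
-/
theorem mono_sub_mono_mem {n m : ℕ} {I : Ideal B} {a b : Fin n → B} (ha : ∀ i, a i ∈ I)
    (hb : ∀ i, b i ∈ I) (hab : ∀ i, a i - b i ∈ I ^ 2) (ρ : MonoIdx n m) :
    mono ρ a - mono ρ b ∈ I ^ (m + 1) := by
  have := prod_pow_sub_prod_pow_mem ha hb hab ρ.1 Finset.univ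
  rwa [sum_monoIdx ρ] at this

end Congruence
-- The quotient by the forms and the recovery of their span.
section GradedQuotient

open MvPolynomial

attribute [local instance] MvPolynomial.gradedAlgebra

variable {n m : ℕ} {p : Fin n → MvPolynomial (Fin n) ℂ} {A : Type*} [CommRing A] [Algebra ℂ A]
  {φ : MvPolynomial (Fin n) ℂ →ₐ[ℂ] A}

theorem span_range_le_pow (hp : ∀ r, (p r).IsHomogeneous m) :
    Ideal.span (Set.range p) ≤ idealOfVars (Fin n) ℂ ^ m := by
  rw [Ideal.span_le]
  rintro _ ⟨r, rfl⟩
  exact mem_pow_idealOfVars_of_isHomogeneous (hp r)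

/-- The preimage of `𝔪` is a prime containing a power of the ideal of the variables, hence that
maximal ideal itself. -/
theorem eq_map_idealOfVars (hφ : Function.Surjective φ)
    (hker : RingHom.ker φ = Ideal.span (Set.range p)) {N : ℕ}
    (hN : idealOfVars (Fin n) ℂ ^ N ≤ Ideal.span (Set.range p)) {𝔪 : Ideal A}
    (h𝔪 : 𝔪.IsMaximal) : 𝔪 = (idealOfVars (Fin n) ℂ).map φ := by
  have hmax : (𝔪.comap φ).IsMaximal := Ideal.comap_isMaximal_of_surjective φ hφ
  have hle : idealOfVars (Fin n) ℂ ≤ 𝔪.comap φ := by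
    refine hmax.isPrime.le_of_pow_le (hN.trans ?_)
    rw [← hker]
    intro f hf
    rw [Ideal.mem_comap, RingHom.mem_ker.1 hf]
    exact zero_mem _
  rw [isMaximal_idealOfVars.eq_of_le hmax.ne_top hle, Ideal.map_comap_of_surjective φ hφ]

theorem isLocalRing_of_surjective (hm : 1 ≤ m) (hp : ∀ r, (p r).IsHomogeneous m)
    (hφ : Function.Surjective φ)
    (hker : RingHom.ker φ = Ideal.span (Set.range p)) {N : ℕ}
    (hN : idealOfVars (Fin n) ℂ ^ N ≤ Ideal.span (Set.range p)) : IsLocalRing A := by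
  have : Nontrivial A := by
    refine ⟨⟨1, 0, fun h => ?_⟩⟩
    have h1 : (1 : MvPolynomial (Fin n) ℂ) ∈ RingHom.ker φ := by
      rw [RingHom.mem_ker, map_one, h]
    rw [hker] at h1
    have h2 := Ideal.pow_le_self (by omega) (span_range_le_pow hp h1)
    exact isMaximal_idealOfVars.ne_top ((Ideal.eq_top_iff_one _).2 h2)
  obtain ⟨I, hI⟩ := Ideal.exists_maximal A
  exact IsLocalRing.of_unique_max_ideal ⟨I, hI, fun J hJ => by
    rw [eq_map_idealOfVars hφ hker hN hI, eq_map_idealOfVars hφ hker hN hJ]⟩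

theorem mem_map_pow_iff (hφ : Function.Surjective φ)
    (hker : RingHom.ker φ = Ideal.span (Set.range p)) {f : MvPolynomial (Fin n) ℂ} {k : ℕ} :
    φ f ∈ (idealOfVars (Fin n) ℂ).map φ ^ k ↔
      f ∈ idealOfVars (Fin n) ℂ ^ k ⊔ Ideal.span (Set.range p) := by
  rw [← Ideal.map_pow, ← hker, ← Ideal.mem_comap, Ideal.comap_map_of_surjective φ hφ]
  rfl

theorem mem_map_pow_iff_of_le (hp : ∀ r, (p r).IsHomogeneous m) (hφ : Function.Surjective φ)
    (hker : RingHom.ker φ = Ideal.span (Set.range p)) {f : MvPolynomial (Fin n) ℂ} {k : ℕ}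
    (hk : k ≤ m) :
    φ f ∈ (idealOfVars (Fin n) ℂ).map φ ^ k ↔ f ∈ idealOfVars (Fin n) ℂ ^ k := by
  rw [mem_map_pow_iff hφ hker, sup_eq_left.2]
  exact (span_range_le_pow hp).trans (Ideal.pow_le_pow_right hk)

/-- The powers of `𝔪` remember the span of the `p r`: in degree `m`, the ideal `M ^ (m + 1)`
contributes nothing and `P` contributes exactly that span. -/
theorem mem_map_pow_succ_iff (hp : ∀ r, (p r).IsHomogeneous m) (hφ : Function.Surjective φ)
    (hker : RingHom.ker φ = Ideal.span (Set.range p)) {f : MvPolynomial (Fin n) ℂ}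
    (hf : f.IsHomogeneous m) :
    φ f ∈ (idealOfVars (Fin n) ℂ).map φ ^ (m + 1) ↔ f ∈ Submodule.span ℂ (Set.range p) := by
  rw [mem_map_pow_iff hφ hker, ← degComp_span_range hp, mem_degComp]
  refine ⟨fun h => ⟨hf, ?_⟩, fun h => (le_sup_right : _ ≤ idealOfVars (Fin n) ℂ ^ (m + 1) ⊔ _) h.2⟩
  obtain ⟨g, hg, h, hh, rfl⟩ := Submodule.mem_sup.1 h
  have hg0 : homogeneousComponent m g = 0 := by
    ext x
    rw [coeff_homogeneousComponent, coeff_zero]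
    split_ifs with hx
    · exact (mem_pow_idealOfVars_iff' _ _).1 hg x (by omega)
    · rfl
  have h1 := homogeneousComponent_eq_self hf
  rw [map_add, hg0, zero_add] at h1
  rw [← h1]
  exact homogeneousComponent_mem_of_mem (isHomogeneous_span_range hp) hh m

theorem isNilIndex_map (hm : 1 ≤ m) (hp : ∀ r, (p r).IsHomogeneous m)
    (hker : RingHom.ker φ = Ideal.span (Set.range p)) {N : ℕ}
    (hN : idealOfVars (Fin n) ℂ ^ N ≤ Ideal.span (Set.range p)) :
    IsNilIndex ((idealOfVars (Fin n) ℂ).map φ) (n * (m - 1)) := by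
  have hiff : ∀ k, (idealOfVars (Fin n) ℂ).map φ ^ k = ⊥ ↔
      idealOfVars (Fin n) ℂ ^ k ≤ Ideal.span (Set.range p) := by
    intro k
    rw [← Ideal.map_pow, ← hker, Ideal.map_eq_bot_iff_le_ker]
  constructor
  · intro h
    obtain ⟨f, hf, hfP⟩ := exists_isHomogeneous_notMem_span_range hm hp hN
    exact hfP ((hiff _).1 h (mem_pow_idealOfVars_of_isHomogeneous hf))
  · intro k hk
    by_contra! hlt
    apply hk
    rw [hiff, pow_idealOfVars_eq_span, Ideal.span_le]
    rintro _ ⟨x, hx, rfl⟩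
    exact isHomogeneous_mem_span_range hm hp hN hlt (isHomogeneous_monomial _ hx)

theorem exists_sub_linForm_mem (hφ : Function.Surjective φ) {x : A}
    (hx : x ∈ (idealOfVars (Fin n) ℂ).map φ) :
    ∃ c, x - φ (linForm c) ∈ (idealOfVars (Fin n) ℂ).map φ ^ 2 := by
  obtain ⟨f, hf, rfl⟩ := (Ideal.mem_map_iff_of_surjective φ hφ).1 hx
  obtain ⟨c, hc⟩ := exists_sub_linForm_mem_sq hf
  refine ⟨c, ?_⟩
  rw [← map_sub, ← Ideal.map_pow]
  exact Ideal.mem_map_of_mem φ hc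

theorem linForm_mem_map (φ : MvPolynomial (Fin n) ℂ →ₐ[ℂ] A) (c : Fin n → ℂ) :
    φ (linForm c) ∈ (idealOfVars (Fin n) ℂ).map φ := by
  have := mem_pow_idealOfVars_of_isHomogeneous (isHomogeneous_linForm c)
  rw [pow_one] at this
  exact Ideal.mem_map_of_mem φ this

theorem map_linForm_mem_sq (hm : 2 ≤ m) (hp : ∀ r, (p r).IsHomogeneous m)
    (hφ : Function.Surjective φ) (hker : RingHom.ker φ = Ideal.span (Set.range p))
    {c : Fin n → ℂ} (h : φ (linForm c) ∈ (idealOfVars (Fin n) ℂ).map φ ^ 2) : c = 0 :=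
  linForm_mem_sq ((mem_map_pow_iff_of_le hp hφ hker hm).1 h)

theorem linForm_eq_linearCombination (c : Fin n → ℂ) :
    linForm c = Fintype.linearCombination ℂ X c := rfl

theorem finrank_cotangent_map (hm : 2 ≤ m) (hp : ∀ r, (p r).IsHomogeneous m)
    (hφ : Function.Surjective φ) (hker : RingHom.ker φ = Ideal.span (Set.range p)) :
    Module.finrank ℂ ((idealOfVars (Fin n) ℂ).map φ).Cotangent = n := by
  set 𝔪 := (idealOfVars (Fin n) ℂ).map φ
  let ℓ : (Fin n → ℂ) →ₗ[ℂ] 𝔪.Cotangent :=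
    { toFun := fun c => 𝔪.toCotangent ⟨φ (linForm c), linForm_mem_map φ c⟩
      map_add' := fun c d => by
        rw [← map_add]
        congr 1
        ext
        simp [linForm_eq_linearCombination]
      map_smul' := fun a c => by
        refine (congrArg 𝔪.toCotangent (Subtype.ext ?_)).trans
          ((𝔪.toCotangent.restrictScalars ℂ).map_smul a ⟨φ (linForm c), linForm_mem_map φ c⟩)
        change φ (linForm (a • c)) = a • φ (linForm c)
        rw [linForm_eq_linearCombination, map_smul, map_smul, linForm_eq_linearCombination] }
  have hbij : Function.Bijective ℓ := by
    constructor
    · rw [injective_iff_map_eq_zero]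
      intro c hc
      exact map_linForm_mem_sq hm hp hφ hker ((𝔪.toCotangent_eq_zero _).1 hc)
    · intro y
      obtain ⟨x, rfl⟩ := 𝔪.toCotangent_surjective y
      obtain ⟨c, hc⟩ := exists_sub_linForm_mem hφ x.2
      refine ⟨c, ?_⟩
      symm
      exact 𝔪.toCotangent_eq.2 hc
  rw [← (LinearEquiv.ofBijective ℓ hbij).finrank_eq, Module.finrank_fin_fun]

/-- The matrix of linear parts of a basis of a complement to `𝔪²` in `𝔪` is invertible. -/
theorem isUnit_linear_part (φ : MvPolynomial (Fin n) ℂ →ₐ[ℂ] A) {𝔪 : Ideal A}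
    {E : Submodule ℂ 𝔪} (hE : IsCompl E (subspaceIn 𝔪 (𝔪 ^ 2)))
    (f : Module.Basis (Fin n) ℂ E) {c : Matrix (Fin n) (Fin n) ℂ}
    (hc : ∀ i, ((f i : 𝔪) : A) - φ (linForm (c i)) ∈ 𝔪 ^ 2) : IsUnit c := by
  rw [← Matrix.linearIndependent_rows_iff_isUnit, Fintype.linearIndependent_iff]
  intro a ha
  -- A relation among the linear parts puts this combination in `𝔪 ^ 2`, which meets the complement
  -- `E` only in zero.
  have hsum : ∑ i, a i • f i = 0 := by
    have h1 : ((∑ i, a i • f i : E) : 𝔪) ∈ subspaceIn 𝔪 (𝔪 ^ 2) := by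
      change (((∑ i, a i • f i : E) : 𝔪) : A) ∈ 𝔪 ^ 2
      have h2 : φ (∑ i, a i • linForm (c i)) = 0 := by
        have : ∑ i, a i • linForm (c i) = linForm (∑ i, a i • c.row i) := by
          simp only [linForm_eq_linearCombination, map_sum, map_smul]
          rfl
        rw [this, ha]
        simp [linForm]
      have h3 : (((∑ i, a i • f i : E) : 𝔪) : A) =
          ∑ i, a i • (((f i : 𝔪) : A) - φ (linForm (c i))) := by
        simp only [smul_sub, Finset.sum_sub_distrib, ← map_smul, ← map_sum, h2, sub_zero]
        simp
      rw [h3]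
      refine Ideal.sum_mem _ fun i _ => ?_
      rw [Algebra.smul_def]
      exact Ideal.mul_mem_left _ _ (hc i)
    have h4 := Submodule.disjoint_def.1 hE.disjoint _ (∑ i, a i • f i : E).2 h1
    exact Subtype.ext h4
  exact Fintype.linearIndependent_iff.1 f.linearIndependent a hsum

/-- A vector of coefficients is a relation modulo `𝔪 ^ (m + 1)` among the monomials in `x`
exactly if the corresponding form becomes a combination of the `p r` after substituting the linear
parts of `x`. -/
theorem relation_iff (hp : ∀ r, (p r).IsHomogeneous m)
    (hφ : Function.Surjective φ) (hker : RingHom.ker φ = Ideal.span (Set.range p))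
    {𝔪 : Ideal A} (h𝔪 : 𝔪 = (idealOfVars (Fin n) ℂ).map φ)
    {x : Fin n → 𝔪} {c : Matrix (Fin n) (Fin n) ℂ}
    (hc : ∀ i, (x i : A) - φ (linForm (c i)) ∈ 𝔪 ^ 2)
    {S : Submodule ℂ ↥(𝔪 ^ m)} (hS : IsCompl S (subspaceIn (𝔪 ^ m) (𝔪 ^ (m + 1))))
    (γ : MonoIdx n m → ℂ) :
    ∑ ρ, γ ρ • Submodule.projectionOnto S _ hS (monoIn 𝔪 ρ x) = 0 ↔
      linSubst c (coeffForm γ) ∈ Submodule.span ℂ (Set.range p) := by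
  rw [← mem_map_pow_succ_iff hp hφ hker (isHomogeneous_linSubst c (isHomogeneous_coeffForm γ)),
    ← h𝔪]
  simp only [← map_smul, ← map_sum]
  rw [Submodule.projectionOnto_apply_eq_zero_iff]
  change ((∑ ρ, γ ρ • monoIn 𝔪 ρ x : ↥(𝔪 ^ m)) : A) ∈ 𝔪 ^ (m + 1) ↔ _
  have h1 : ((∑ ρ, γ ρ • monoIn 𝔪 ρ x : ↥(𝔪 ^ m)) : A) =
      ∑ ρ, γ ρ • mono ρ fun i => (x i : A) := by
    simp [monoIn]
  have h2 : φ (linSubst c (coeffForm γ)) = ∑ ρ, γ ρ • mono ρ fun i => φ (linForm (c i)) := by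
    rw [← aeval_coeffForm, linSubst, ← AlgHom.comp_apply, comp_aeval]
  rw [h1, h2]
  have h3 : ∑ ρ, γ ρ • mono ρ (fun i => (x i : A)) -
      ∑ ρ, γ ρ • mono ρ (fun i => φ (linForm (c i))) ∈ 𝔪 ^ (m + 1) := by
    rw [← Finset.sum_sub_distrib]
    refine Ideal.sum_mem _ fun ρ _ => ?_
    rw [← smul_sub, Algebra.smul_def]
    exact Ideal.mul_mem_left _ _ (mono_sub_mono_mem (fun i => (x i).2)
      (fun i => h𝔪 ▸ linForm_mem_map φ (c i)) hc ρ)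
  exact ⟨fun h => by simpa using Ideal.sub_mem _ h h3, fun h => by simpa using Ideal.add_mem _ h3 h⟩

/-- The rows are the coefficient vectors of the `p r` after the inverse substitution. -/
theorem exists_relation_forms (hp : ∀ r, (p r).IsHomogeneous m) (hli : LinearIndependent ℂ p)
    {c : Matrix (Fin n) (Fin n) ℂ} (hc : IsUnit c) :
    ∃ Γ : Matrix (Fin n) (MonoIdx n m) ℂ, LinearIndependent ℂ Γ.row ∧
      ∀ r, linSubst c (coeffForm (Γ r)) ∈ Submodule.span ℂ (Set.range p) := by
  have hdet := (Matrix.isUnit_iff_isUnit_det c).1 hc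
  choose Γ hΓ using fun r => exists_coeffForm_eq (isHomogeneous_linSubst c⁻¹ (hp r))
  have hΓ' : ∀ r, linSubst c (coeffForm (Γ r)) = p r := fun r => by
    rw [hΓ, linSubst_linSubst, Matrix.nonsing_inv_mul _ hdet, linSubst_one]
  refine ⟨Γ, ?_, fun r => by rw [hΓ']; exact Submodule.subset_span ⟨r, rfl⟩⟩
  refine LinearIndependent.of_comp ((linSubst c).toLinearMap ∘ₗ
    Fintype.linearCombination ℂ fun ρ : MonoIdx n m => mono ρ X) ?_
  have h : ((linSubst c).toLinearMap ∘ₗ Fintype.linearCombination ℂ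
      fun ρ : MonoIdx n m => mono ρ X) ∘ Matrix.row Γ = p := funext hΓ'
  rw [h]
  exact hli

/-- Expanding the substituted forms in the `p r` gives `Γ q(c z) = M P(z)` for a square matrix `M`.
Substitution by `c` is injective, so independent rows of `Γ` force `M` to be invertible. -/
theorem linearlyEquivalent_of_relations {c : Matrix (Fin n) (Fin n) ℂ} (hc : IsUnit c)
    {Γ : Matrix (Fin n) (MonoIdx n m) ℂ} (hΓ : LinearIndependent ℂ Γ.row)
    (hrel : ∀ r, linSubst c (coeffForm (Γ r)) ∈ Submodule.span ℂ (Set.range p)) :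
    LinearlyEquivalent (recMap Γ) (polyMap p) := by
  have hdet := (Matrix.isUnit_iff_isUnit_det c).1 hc
  choose M hM using fun r => (Submodule.mem_span_range_iff_exists_fun ℂ).1 (hrel r)
  let M : Matrix (Fin n) (Fin n) ℂ := M
  let ψ := (linSubst c).toLinearMap ∘ₗ
    Fintype.linearCombination ℂ fun ρ : MonoIdx n m => mono ρ (X : Fin n → MvPolynomial (Fin n) ℂ)
  have hψ : Function.Injective ψ := by
    refine Function.Injective.comp (g := linSubst c) ?_ ((injective_iff_map_eq_zero _).2
      fun γ hγ => funext (Fintype.linearIndependent_iff.1 (linearIndependent_mono_X m) γ hγ))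
    refine Function.LeftInverse.injective (g := linSubst c⁻¹) fun f => ?_
    rw [linSubst_linSubst, Matrix.mul_nonsing_inv _ hdet, linSubst_one]
  have hMu : IsUnit M := by
    rw [← Matrix.linearIndependent_rows_iff_isUnit]
    refine LinearIndependent.of_comp (Fintype.linearCombination ℂ p) ?_
    have h : Fintype.linearCombination ℂ p ∘ M.row = ψ ∘ Γ.row := funext hM
    rw [h]
    exact hΓ.map' ψ (LinearMap.ker_eq_bot.2 hψ)
  have hMdet := (Matrix.isUnit_iff_isUnit_det M).1 hMu
  have hMi : IsUnit M⁻¹ := (Matrix.isUnit_nonsing_inv_iff).2 hMu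
  refine ⟨M⁻¹.toLinearEquiv' hMi.invertible, c.toLinearEquiv' hc.invertible, ?_⟩
  funext z
  have h1 : recMap Γ (c.mulVec z) = M.mulVec (polyMap p z) := by
    funext r
    rw [← eval_coeffForm, ← eval_linSubst, ← hM r, map_sum]
    simp [Matrix.mulVec, dotProduct, polyMap, smul_eval, M]
  change _ = M⁻¹.mulVec (recMap Γ (c.mulVec z))
  rw [h1, Matrix.mulVec_mulVec, Matrix.nonsing_inv_mul _ hMdet, Matrix.one_mulVec]

end GradedQuotient
end FinitePolyMap

/-! ### Assembly of the theorem. -/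

theorem mainTheorem1 {n m : ℕ} (hn : 2 ≤ n) (hm : 2 ≤ m)
    (p : Fin n → MvPolynomial (Fin n) ℂ) (hp : ∀ r, (p r).IsHomogeneous m)
    (hfin : Module.Finite ℂ (FinitePolyMap.GermAlg p))
    {A : Type*} [CommRing A] [Algebra ℂ A] (e : A ≃ₐ[ℂ] FinitePolyMap.GermAlg p) :
    IsLocalRing A ∧
    ∀ 𝔪 : Ideal A, 𝔪.IsMaximal →
      n = Module.finrank ℂ 𝔪.Cotangent ∧
      (∃ ν : ℕ, FinitePolyMap.IsNilIndex 𝔪 ν ∧ n ∣ ν ∧ m = ν / n + 1) ∧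
      ∀ (E : Submodule ℂ 𝔪), IsCompl E (FinitePolyMap.subspaceIn 𝔪 (𝔪 ^ 2)) →
      ∀ (f : Module.Basis (Fin n) ℂ E)
        (S : Submodule ℂ ↥(𝔪 ^ m))
        (hS : IsCompl S (FinitePolyMap.subspaceIn (𝔪 ^ m) (𝔪 ^ (m + 1)))),
        (∃ Γ : Matrix (Fin n) (FinitePolyMap.MonoIdx n m) ℂ,
          FinitePolyMap.IsRelationMatrix 𝔪 (fun i => (f i : 𝔪)) S hS Γ) ∧
        ∀ Γ : Matrix (Fin n) (FinitePolyMap.MonoIdx n m) ℂ,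
          FinitePolyMap.IsRelationMatrix 𝔪 (fun i => (f i : 𝔪)) S hS Γ →
          FinitePolyMap.LinearlyEquivalent (FinitePolyMap.recMap Γ)
            (FinitePolyMap.polyMap p) := by
  have hφ₀ := FinitePolyMap.toGermAlg_surjective hp
  obtain ⟨N, hN⟩ := FinitePolyMap.exists_pow_idealOfVars_le hp
  let φ : MvPolynomial (Fin n) ℂ →ₐ[ℂ] A := e.symm.toAlgHom.comp (FinitePolyMap.toGermAlg p)
  have hφ : Function.Surjective φ := e.symm.surjective.comp hφ₀
  have hker : RingHom.ker φ = Ideal.span (Set.range p) := by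
    rw [← FinitePolyMap.ker_toGermAlg hp]
    ext f
    exact e.symm.map_eq_zero_iff
  have hm1 : 1 ≤ m := by omega
  refine ⟨FinitePolyMap.isLocalRing_of_surjective hm1 hp hφ hker hN, fun 𝔪 h𝔪 => ?_⟩
  obtain rfl := FinitePolyMap.eq_map_idealOfVars hφ hker hN h𝔪
  refine ⟨(FinitePolyMap.finrank_cotangent_map hm hp hφ hker).symm,
    ⟨n * (m - 1), FinitePolyMap.isNilIndex_map hm1 hp hker hN, dvd_mul_right _ _, ?_⟩, ?_⟩
  · rw [Nat.mul_div_cancel_left _ (by omega)]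
    omega
  intro E hE f S hS
  choose c hc using fun i => FinitePolyMap.exists_sub_linForm_mem hφ (f i : Ideal.map φ _).2
  have hcu : IsUnit (Matrix.of c) := FinitePolyMap.isUnit_linear_part φ hE f hc
  have hrel := FinitePolyMap.relation_iff hp hφ hker rfl (c := Matrix.of c) hc hS
  constructor
  · obtain ⟨Γ, hΓ, hΓ'⟩ := FinitePolyMap.exists_relation_forms hp
      (FinitePolyMap.linearIndependent_and_finrank_degComp hm1 hp hN).1 hcu
    exact ⟨Γ, hΓ, fun r => (hrel _).2 (hΓ' r)⟩
  · rintro Γ ⟨hΓ, hΓ'⟩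
    exact FinitePolyMap.linearlyEquivalent_of_relations hcu hΓ fun r => (hrel _).1 (hΓ' r)
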